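/- **Setting.** Let $\{f(y,\beta):\beta=(\theta,\gamma)\in B\}$, $B\subset\mathbb R^{p+q}$ open ($p,q\ge 0$), be probability densities with respect to a $\sigma$-finite measure, and let $\beta_0=(\theta_0,\gamma_0)\in B$ and $\delta\in\mathbb R^q$. For each $n$ the data $Y_1,\dots,Y_n$ are i.i.d. with density $f(\cdot,\beta_{\rm true})$, where $\beta_{\rm true}=\beta_{{\rm true},n}=(\theta_0,\gamma_0+\delta/\sqrt n)\in B$; $\mathbb E$ denotes expectation under this law. Assume the usual regularity conditions: the support of $f(\cdot,\beta)$ does not depend on $\beta$; on a neighbourhood $U$ of $\beta_0$ the map $\beta\mapsto\log f(y,\beta)$ is twice continuously differentiable, and $\|\nabla\log f(y,\beta)\|^2\le b(y)$, $\|\nabla^2\log f(y,\beta)\|\le b(y)$ for all $\beta\in U$, where for some $\varepsilon>0$ the moments $\int b(y)^{1+\varepsilon}f(y,\beta)\,dy$ are finite and bounded over $\beta\in U$; and $J=\operatorname{var}_{\beta_0}S(Y)=\begin{pmatrix}J_{00}&J_{01}\\J_{10}&J_{11}\end{pmatrix}$ is positive definite, where $S=(U,V)=(\partial_\theta,\partial_\gamma)\log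 f(\cdot,\beta)|_{\beta=\beta_0}$. Let $\mu:\mathbb R^{p+q}\to\mathbb R$ be continuously differentiable near $\beta_0$. Let $\mathcal M$ be any set of candidate models $k\subset\{1,\dots,q\}$, with weights $0\le w_k\le 1$, $\sum_{k\in\mathcal M}w_k=1$. Model $k$ has parameter $b=(\theta,\gamma_k)\in\mathbb R^{p+|k|}$, augmented to $\tilde b=(b,\gamma_{0,k^c})\in\mathbb R^{p+q}$, and log-likelihood $\ell_k(b)=\sum_i\ell_{k;i}(b)$, $\ell_{k;i}(b)=\log f(Y_i,\tilde b)$. Let $\beta_{0,k}=(\theta_0,\gamma_{0,k})$, let $\pi_k$ be the projection $\mathbb R^q\to\mathbb R^{|k|}$, let $J_k$ be the submatrix of $J$ for the coordinates of model $k$, and let $\nabla_k\mu=(\partial\mu/\partial\theta,\partial\mu/\partial\gamma_k)$. For $z=(u,v)\in\mathbb R^{p+q}$ put $$\Lambda_k(z)=\nabla_k\mu(\beta_0)^\top\Big\{J_k^{-1}\begin{pmatrix}J_{01}\delta\\ \pi_kJ_{11}\delta\end{pmatrix}+J_k^{-1}\begin{pmatrix}u\\ \pi_kv\end{pmatrix}\Big\}-\Big(\frac{\partial\mu(\beta_0)}{\partial\gamma}\Big)^\top\delta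 .$$ The Hjort–Claeskens limit is $\sum_kw_k\Lambda_k=\sum_kw_k\Lambda_k(Z)$ with $Z\sim\mathcal N(0,J)$; its version for sample size $n$ has $Z$ replaced by $Z_n=\sqrt n\,\big(\tfrac1n\sum_iS(Y_i)-\mathbb E S(Y_1)\big)$. **Statement.** There is $r>0$ such that for every $k\in\mathcal M$ and all large $n$ the equation $\mathbb E\,\ell_{k;1}'(b)=0$ has exactly one solution $b$ with $\|b-\beta_{0,k}\|<r$. Let $\beta_k^*=\beta^*_{k,n}$ be this solution and $\tilde\beta^*_k$ its augmentation. Then: 1. The bias term of the general theory, $\sqrt n\sum_kw_k\{\mu(\tilde\beta_k^*)-\mu(\beta_{\rm true})\}$, converges to the mean of $\sum_kw_k\Lambda_k$. 2. For large $n$, $\ell_{k;1}'(\beta_k^*)$ is square integrable and $\ell_{k;1}''(\beta_k^*)$ is integrable; the limits $H_k=\lim_n\frac1n\mathbb E[\ell_k''(\beta_k^*)]$ exist and are invertible; and with $D_i=\max_{k\in\mathcal M}|\nabla_k\mu(\tilde\beta_k^*)^\top H_k^{-1}\ell_{k;i}'(\beta_k^*)|$, $\frac1n\sum_i\mathbb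 E[D_i^2\,\mathbb 1\{D_i>\sqrt n\,\varepsilon\}]\to0$ for every $\varepsilon>0$. 3. The asymptotic variance $\Sigma_w=\lim_n\frac1n\sum_{i=1}^n\mathbb E\big[\big(\sum_kw_k\nabla_k\mu(\tilde\beta_k^*)^\top H_k^{-1}\ell_{k;i}'(\beta_k^*)\big)^2\big]$ of the general theory exists and equals the variance of $\sum_kw_k\Lambda_k$. 4. $\sum_kw_k\Lambda_k(Z_n)$ is square integrable for large $n$, its mean then equals that of $\sum_kw_k\Lambda_k$, and its variance converges to $\Sigma_w$. 5. Consequently, for arbitrary estimators $\hat\beta_k$ of the parameters of the candidate models (in particular maximum likelihood estimators), with augmentations $\tilde\beta_k$, the limit theorem $$\sqrt n\sum_kw_k\{\mu(\tilde\beta_k)-\mu(\beta_{\rm true})\}-\sqrt n\sum_kw_k\{\mu(\tilde\beta_k^*)-\mu(\beta_{\rm true})\}\to\mathcal N(0,\Sigma_w)\quad\text{in distribution}$$ of the general theory holds if and only if the Hjort–Claeskens limit theorem $\sqrt n\big(\sum_kw_k\mu(\tilde\beta_k)-\mu(\beta_{\rm true})\big)\to\sum_kw_k\Lambda_k$ in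 distribution holds. -/

import Mathlib

open MeasureTheory ProbabilityTheory Filter
open scoped Topology NNReal ENNReal Matrix

namespace ModelAveraging

noncomputable section

/-- Full parameters `β = (θ, γ)` with `θ ∈ ℝ^p` and `γ ∈ ℝ^q`. -/
abbrev Param (p q : ℕ) := EuclideanSpace ℝ (Fin p ⊕ Fin q)

/-- Parameters `(θ, γ_k)` of the candidate model that contains the components of `γ` with index in
the set `k`. -/
abbrev SubParam (p : ℕ) {q : ℕ} (k : Finset (Fin q)) := EuclideanSpace ℝ (Fin p ⊕ k)

/-- The coordinates of a candidate model, as coordinates of the full model. -/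
def incl (p : ℕ) {q : ℕ} (k : Finset (Fin q)) : Fin p ⊕ k → Fin p ⊕ Fin q :=
  Sum.map id Subtype.val

/-- The subvector with the coordinates of the candidate model `k`. -/
def restrict {p q : ℕ} (k : Finset (Fin q)) (β : Param p q) : SubParam p k :=
  WithLp.toLp 2 fun i => β (incl p k i)

/-- The augmented parameter `(b, γ_{0,kᶜ})`: the components of `γ` that are missing in the candidate
model `k` are set to their values in `β₀ = (θ₀, γ₀)`. -/
def augment {p q : ℕ} (β₀ : Param p q) (k : Finset (Fin q)) (b : SubParam p k) : Param p q :=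
  WithLp.toLp 2 (Sum.elim (fun i => b (Sum.inl i))
    (fun j => if h : j ∈ k then b (Sum.inr ⟨j, h⟩) else β₀ (Sum.inr j)))

/-- The locally perturbed parameter `(θ₀, γ₀ + δ/√n)`. -/
def localParam {p q : ℕ} (β₀ : Param p q) (δ : Fin q → ℝ) (n : ℕ) : Param p q :=
  WithLp.toLp 2 (Sum.elim (fun i => β₀ (Sum.inl i)) (fun j => β₀ (Sum.inr j) + δ j / √(n : ℝ)))

/-- A parametric family of probability densities `f(y, β)`, with respect to a σ-finite measure `ν`,
whose parameter `β = (θ, γ)` ranges over an open subset of `ℝ^(p+q)`. -/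
structure ParametricModel (p q : ℕ) (𝒴 : Type*) [MeasurableSpace 𝒴] where
  /-- dominating measure -/
  ν : Measure 𝒴
  sigmaFinite : SigmaFinite ν
  /-- parameter space -/
  par : Set (Param p q)
  isOpen_par : IsOpen par
  /-- the density -/
  f : Param p q → 𝒴 → ℝ
  measurable_f : ∀ β ∈ par, Measurable (f β)
  nonneg_f : ∀ β ∈ par, ∀ y, 0 ≤ f β y
  lintegral_f : ∀ β ∈ par, ∫⁻ y, ENNReal.ofReal (f β y) ∂ν = 1

namespace ParametricModel

variable {p q : ℕ} {𝒴 : Type*} [MeasurableSpace 𝒴] (M : ParametricModel p q 𝒴)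

/-- The distribution of one observation under the parameter `β`. -/
def law (β : M.par) : Measure 𝒴 := M.ν.withDensity fun y => ENNReal.ofReal (M.f β y)

instance (β : M.par) : IsProbabilityMeasure (M.law β) :=
  ⟨by simpa [law] using M.lintegral_f β β.2⟩

/-- The distribution of an i.i.d. sample `Y₁, …, Y_n` under the parameter `β`. -/
def sampleLaw (n : ℕ) (β : M.par) : Measure (Fin n → 𝒴) := Measure.pi fun _ => M.law β

instance (n : ℕ) (β : M.par) : IsProbabilityMeasure (M.sampleLaw n β) := by
  unfold sampleLaw; infer_instance

/-- The score `(U(y), V(y))` of the full model: gradient of `log f(y, ·)` at `β`. -/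
def score (y : 𝒴) (β : Param p q) : Param p q := gradient (fun β' => Real.log (M.f β' y)) β

/-- The log-likelihood of one observation in the candidate model `k`. -/
def subLogLik (β₀ : Param p q) (k : Finset (Fin q)) (y : 𝒴) (b : SubParam p k) : ℝ :=
  Real.log (M.f (augment β₀ k b) y)

/-- The score `ℓ'_k` of one observation in the candidate model `k`. -/
def subScore (β₀ : Param p q) (k : Finset (Fin q)) (y : 𝒴) (b : SubParam p k) : SubParam p k :=
  gradient (M.subLogLik β₀ k y) b

/-- The Hessian matrix `ℓ''_k` of the log-likelihood of one observation in the candidate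
model `k`. -/
def subHessian (β₀ : Param p q) (k : Finset (Fin q)) (y : 𝒴) (b : SubParam p k) :
    Matrix (Fin p ⊕ k) (Fin p ⊕ k) ℝ :=
  Matrix.of fun i j =>
    fderiv ℝ (fun b' => M.subScore β₀ k y b' i) b (EuclideanSpace.single j 1)

/-- `b` solves the population score equation `E S_k(b) = 0` of the candidate model `k`, where the
expectation is taken under the true parameter `β`. -/
def IsScoreRoot (β₀ : Param p q) (β : M.par) (k : Finset (Fin q)) (b : SubParam p k) : Prop :=
  augment β₀ k b ∈ M.par ∧ Integrable (fun y => M.subScore β₀ k y b) (M.law β) ∧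
    ∫ y, M.subScore β₀ k y b ∂(M.law β) = 0

/-- `n⁻¹ E[ℓ''_k(b)]`, where `ℓ_k` is the log-likelihood of the whole sample and the expectation is
taken under the true parameter `β`. -/
def meanHessian (β₀ : Param p q) (n : ℕ) (β : M.par) (k : Finset (Fin q)) (b : SubParam p k) :
    Matrix (Fin p ⊕ k) (Fin p ⊕ k) ℝ :=
  Matrix.of fun i j =>
    (1 / (n : ℝ)) * ∫ Y, (∑ l, M.subHessian β₀ k (Y l) b i j) ∂(M.sampleLaw n β)

/-- `J_full = var S(Y)`: covariance matrix of the score at `β₀`, under `β₀`. -/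
def fisher (β₀ : M.par) : Matrix (Fin p ⊕ Fin q) (Fin p ⊕ Fin q) ℝ :=
  Matrix.of fun i j => cov[fun y => M.score y β₀ i, fun y => M.score y β₀ j; M.law β₀]

/-- `J_k = var (U(Y), V_k(Y))`. -/
def subFisher (β₀ : M.par) (k : Finset (Fin q)) : Matrix (Fin p ⊕ k) (Fin p ⊕ k) ℝ :=
  (M.fisher β₀).submatrix (incl p k) (incl p k)

/-- The usual regularity conditions of likelihood asymptotics near `β₀`: common support; the
log-density is twice continuously differentiable on a neighbourhood `U` of `β₀`; on `U` the squared
norm of the score and the norm of the second derivative have a common envelope with a bounded moment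
of an order above one under the parameters in `U`; the Fisher information is positive definite. -/
structure Regular (β₀ : M.par) : Prop where
  support : ∀ β ∈ M.par, ∀ β' ∈ M.par, ∀ y, 0 < M.f β y → 0 < M.f β' y
  smooth : ∃ U : Set (Param p q), IsOpen U ∧ (β₀ : Param p q) ∈ U ∧ U ⊆ M.par ∧
    (∀ y, ContDiffOn ℝ 2 (fun β => Real.log (M.f β y)) U) ∧
    ∃ (B : 𝒴 → ℝ) (ε K : ℝ), Measurable B ∧ 0 < ε ∧
      (∀ y, ∀ β ∈ U, ‖M.score y β‖ ^ 2 ≤ B y ∧ ‖fderiv ℝ (M.score y) β‖ ≤ B y) ∧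
      ∀ β : M.par, (β : Param p q) ∈ U →
        Integrable (fun y => B y ^ (1 + ε)) (M.law β) ∧ ∫ y, B y ^ (1 + ε) ∂(M.law β) ≤ K
  posDef : (M.fisher β₀).PosDef

/-- The projection matrix `π_k : ℝ^q → ℝ^k`. -/
def proj (k : Finset (Fin q)) : Matrix k (Fin q) ℝ :=
  Matrix.of fun i j => if (i : Fin q) = j then 1 else 0

/-- The partial derivatives `(∂μ/∂θ, ∂μ/∂γ_k)` at the full parameter `β`. -/
def subGrad (μ : Param p q → ℝ) (k : Finset (Fin q)) (β : Param p q) : Fin p ⊕ k → ℝ :=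
  fun i => gradient μ β (incl p k i)

/-- The Hjort–Claeskens variable `Λ_k`, as a function of the value `z` of the centred and scaled
score vector `(√n (Ū_n - E U), √n (V̄_n - E V))` or of its Gaussian limit. -/
def hcLambda (β₀ : M.par) (δ : Fin q → ℝ) (μ : Param p q → ℝ) (k : Finset (Fin q))
    (z : Param p q) : ℝ :=
  subGrad μ k β₀ ⬝ᵥ
      ((M.subFisher β₀ k)⁻¹ *ᵥ
          (Sum.elim ((M.fisher β₀).toBlocks₁₂ *ᵥ δ) (proj k *ᵥ ((M.fisher β₀).toBlocks₂₂ *ᵥ δ)))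
        + (M.subFisher β₀ k)⁻¹ *ᵥ (fun i => z (incl p k i)))
    - (fun j => gradient μ β₀ (Sum.inr j)) ⬝ᵥ δ

/-- `∑_k w_k Λ_k`. -/
def hcSum (β₀ : M.par) (δ : Fin q → ℝ) (μ : Param p q → ℝ) (𝓜 : Finset (Finset (Fin q)))
    (w : Finset (Fin q) → ℝ) (z : Param p q) : ℝ :=
  ∑ k ∈ 𝓜, w k * M.hcLambda β₀ δ μ k z

/-- `√n (S̄_n - E S(Y₁))`, for the score `S = (U, V)` at `β₀` and the expectation under the true
parameter `β`. -/
def scaledScore (β₀ : M.par) (n : ℕ) (β : M.par) (Y : Fin n → 𝒴) : Param p q :=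
  √(n : ℝ) • ((1 / (n : ℝ)) • (∑ i, M.score (Y i) β₀) - ∫ y, M.score y β₀ ∂(M.law β))

/-- `∇μ(b, γ_{0,kᶜ})ᵀ H⁻¹ ℓ'_k(b)` for one observation `y`. -/
def influence (β₀ : M.par) (μ : Param p q → ℝ) (k : Finset (Fin q))
    (H : Matrix (Fin p ⊕ k) (Fin p ⊕ k) ℝ) (b : SubParam p k) (y : 𝒴) : ℝ :=
  subGrad μ k (augment β₀ k b) ⬝ᵥ (H⁻¹ *ᵥ (fun i => M.subScore β₀ k y b i))

end ParametricModel

end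

end ModelAveraging

open ModelAveraging

/-!
The argument rests on one analytic fact: near `β₀` the expected score
`Ψ(β, b) = E_β S(Y, b)` (`meanScore`) is continuously differentiable in the pair of the true parameter
`β` and the model parameter `b`. There is no integrable function that dominates all densities
near `β₀`, but on the sets `{b(y) ≤ n + 1}` given by the envelope all densities are bounded by a
multiple of `f(·, β₀)`, because `log f` is Lipschitz there. The integrals over the complements are
small uniformly in the parameter, by the moment of order `1 + ε`. This gives dominated convergence
along moving densities (`LocalEnvelope.tendsto_integral`) and differentiation under the integral
sign (`LocalEnvelope.hasFDerivAt_integral`).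

Differentiating `∫ f(y, β) dy = 1` shows `Ψ(β, β) = 0`, so the two partial derivatives of `Ψ` at
`(β₀, β₀)` are opposite; the one in the true parameter is `J` (`LocalEnvelope.meanScoreDeriv_center`).
For a candidate model `k`, with `R_k` the restriction to its coordinates, the expected score is
`R_k Ψ(β, (b, γ_{0,kᶜ}))`, and its derivative in `b` is `-J_k`. The implicit function theorem
therefore represents the roots near `β_{0,k}` as `b = φ_k(β)` with `Dφ_k(β₀) = J_k⁻¹ R_k J`
(`LocalEnvelope.exists_root_function`). The limit of the bias is the derivative of
`β ↦ μ(φ_k(β), γ_{0,kᶜ}) - μ(β)` at `β₀` in the direction `(0, δ)`, which is the mean of `Λ_k`.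

The mean Hessian is a partial derivative of `Ψ`, hence converges to `H_k = -J_k`, and the influence
functions converge to the linear forms `-⟪c_k, S(y, β₀)⟫` whose coefficients are those of `Λ_k`.
Dominated convergence along the moving law yields the Lindeberg condition and the asymptotic
variance `E_{β₀} ⟪c, S⟫² = cᵀ J c`, the variance of the Gaussian limit. Finally the two centred
statistics differ by the bias term, a convergent sequence of constants, so that the two limit
theorems are equivalent (`tendstoInDistribution_add_const`).
-/

namespace ModelAveraging

namespace ParametricModel

variable {p q : ℕ} {𝒴 : Type*} [MeasurableSpace 𝒴] {M : ParametricModel p q 𝒴}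

/-! ### Local envelopes -/

/-- The regularity conditions in the form in which they are used: on a ball around `β₀`, with an
envelope `b ≥ 1`, and with the moments written as integrals against the dominating measure. -/
structure LocalEnvelope (M : ParametricModel p q 𝒴) (β₀ : Param p q) (ρ : ℝ) (b : 𝒴 → ℝ)
    (ε K : ℝ) : Prop where
  radius_pos : 0 < ρ
  ball_subset : Metric.ball β₀ ρ ⊆ M.par
  support : ∀ β ∈ M.par, ∀ β' ∈ M.par, ∀ y, 0 < M.f β y → 0 < M.f β' y
  contDiffOn : ∀ y, ContDiffOn ℝ 2 (fun β => Real.log (M.f β y)) (Metric.ball β₀ ρ)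
  measurable : Measurable b
  one_le : ∀ y, 1 ≤ b y
  exponent_pos : 0 < ε
  norm_score_sq_le : ∀ y, ∀ β ∈ Metric.ball β₀ ρ, ‖M.score y β‖ ^ 2 ≤ b y
  norm_fderiv_score_le : ∀ y, ∀ β ∈ Metric.ball β₀ ρ, ‖fderiv ℝ (M.score y) β‖ ≤ b y
  integrable_moment : ∀ β ∈ Metric.ball β₀ ρ,
    Integrable (fun y => M.f β y * b y ^ (1 + ε)) M.ν
  moment_le : ∀ β ∈ Metric.ball β₀ ρ, ∫ y, M.f β y * b y ^ (1 + ε) ∂M.ν ≤ K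

lemma integral_law {E : Type*} [NormedAddCommGroup E] [NormedSpace ℝ E] (β : M.par) (g : 𝒴 → E) :
    ∫ y, g y ∂(M.law β) = ∫ y, M.f β y • g y ∂M.ν := by
  rw [law, integral_withDensity_eq_integral_toReal_smul
    (M.measurable_f β β.2).ennreal_ofReal (by simp)]
  simp [ENNReal.toReal_ofReal (M.nonneg_f β β.2 _)]

lemma integrable_law_iff {E : Type*} [NormedAddCommGroup E] [NormedSpace ℝ E] (β : M.par)
    (g : 𝒴 → E) :
    Integrable g (M.law β) ↔ Integrable (fun y => M.f β y • g y) M.ν := by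
  rw [law, integrable_withDensity_iff_integrable_smul'
    (M.measurable_f β β.2).ennreal_ofReal (by simp)]
  simp [ENNReal.toReal_ofReal (M.nonneg_f β β.2 _)]

lemma integrable_f {β : Param p q} (hβ : β ∈ M.par) : Integrable (M.f β) M.ν := by
  have := (integrable_law_iff (M := M) ⟨β, hβ⟩ (fun _ => (1 : ℝ))).1 (integrable_const _)
  simpa using this

lemma integral_f {β : Param p q} (hβ : β ∈ M.par) : ∫ y, M.f β y ∂M.ν = 1 := by
  have := integral_law (M := M) ⟨β, hβ⟩ (fun _ => (1 : ℝ))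
  simpa using this.symm

lemma Regular.exists_localEnvelope {β₀ : M.par} (h : M.Regular β₀) :
    ∃ (ρ : ℝ) (b : 𝒴 → ℝ) (ε K : ℝ), M.LocalEnvelope β₀ ρ b ε K := by
  obtain ⟨U, hU, hβU, hUM, hsm, B, ε, K, hB, hε, hbd, hmom⟩ := h.smooth
  obtain ⟨ρ, hρ, hball⟩ := Metric.isOpen_iff.1 hU β₀ hβU
  have hB0 : ∀ y, 0 ≤ B y := fun y => (sq_nonneg _).trans (hbd y β₀ hβU).1
  have hle : ∀ y, (max (B y) 1) ^ (1 + ε) ≤ B y ^ (1 + ε) + 1 := by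
    intro y
    rcases max_cases (B y) 1 with ⟨h1, -⟩ | ⟨h1, -⟩ <;> rw [h1]
    · linarith
    · rw [Real.one_rpow]; linarith [Real.rpow_nonneg (hB0 y) (1 + ε)]
  have hmeas : Measurable fun y => max (B y) 1 := hB.max measurable_const
  have hint : ∀ β : M.par, (β : Param p q) ∈ U →
      Integrable (fun y => (max (B y) 1) ^ (1 + ε)) (M.law β) := by
    intro β hβ
    refine ((hmom β hβ).1.add (integrable_const 1)).mono'
      (hmeas.pow_const _).aestronglyMeasurable (ae_of_all _ fun y => ?_)
    rw [Real.norm_of_nonneg (Real.rpow_nonneg (le_trans zero_le_one (le_max_right _ _)) _)]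
    exact hle y
  refine ⟨ρ, fun y => max (B y) 1, ε, K + 1, hρ, hball.trans hUM, h.support,
    fun y => (hsm y).mono hball, hmeas, fun y => le_max_right _ _, hε,
    fun y β hβ => (hbd y β (hball hβ)).1.trans (le_max_left _ _),
    fun y β hβ => (hbd y β (hball hβ)).2.trans (le_max_left _ _), fun β hβ => ?_, fun β hβ => ?_⟩
  · exact (integrable_law_iff ⟨β, hUM (hball hβ)⟩ _).1 (hint ⟨β, hUM (hball hβ)⟩ (hball hβ))
  · have h1 := hmom ⟨β, hUM (hball hβ)⟩ (hball hβ)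
    have h2 := integral_law (M := M) ⟨β, hUM (hball hβ)⟩ (fun y => (max (B y) 1) ^ (1 + ε))
    simp only [smul_eq_mul] at h2
    rw [← h2]
    calc _ ≤ ∫ y, (B y ^ (1 + ε) + 1) ∂(M.law ⟨β, hUM (hball hβ)⟩) :=
          integral_mono (hint _ (hball hβ)) (h1.1.add (integrable_const 1)) hle
      _ ≤ K + 1 := by
          rw [integral_add h1.1 (integrable_const 1)]
          simpa using h1.2

namespace LocalEnvelope

variable {β₀ β : Param p q} {ρ ε K : ℝ} {b : 𝒴 → ℝ}

lemma center_mem (h : M.LocalEnvelope β₀ ρ b ε K) : β₀ ∈ Metric.ball β₀ ρ :=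
  Metric.mem_ball_self h.radius_pos

lemma nonneg (h : M.LocalEnvelope β₀ ρ b ε K) (y : 𝒴) : 0 ≤ b y := zero_le_one.trans (h.one_le y)

lemma norm_score_le (h : M.LocalEnvelope β₀ ρ b ε K) (y : 𝒴) (hβ : β ∈ Metric.ball β₀ ρ) :
    ‖M.score y β‖ ≤ b y := by
  have h1 := h.norm_score_sq_le y β hβ
  have h2 := h.one_le y
  by_contra! h3
  nlinarith [norm_nonneg (M.score y β)]

/-! ### Derivatives of the density and of the score -/

lemma hasGradientAt_log (h : M.LocalEnvelope β₀ ρ b ε K) (y : 𝒴) (hβ : β ∈ Metric.ball β₀ ρ) :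
    HasGradientAt (fun β' => Real.log (M.f β' y)) (M.score y β) β :=
  (((h.contDiffOn y).contDiffAt (Metric.isOpen_ball.mem_nhds hβ)).differentiableAt
    (by norm_num)).hasGradientAt

lemma contDiffOn_score (h : M.LocalEnvelope β₀ ρ b ε K) (y : 𝒴) :
    ContDiffOn ℝ 1 (M.score y) (Metric.ball β₀ ρ) := by
  have h1 : ContDiffOn ℝ 1 (fderiv ℝ (fun β' => Real.log (M.f β' y))) (Metric.ball β₀ ρ) :=
    (h.contDiffOn y).fderiv_of_isOpen Metric.isOpen_ball (by norm_num)
  exact (InnerProductSpace.toDual ℝ (Param p q)).symm.contDiff.comp_contDiffOn h1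

lemma hasFDerivAt_score (h : M.LocalEnvelope β₀ ρ b ε K) (y : 𝒴) (hβ : β ∈ Metric.ball β₀ ρ) :
    HasFDerivAt (M.score y) (fderiv ℝ (M.score y) β) β :=
  (((h.contDiffOn_score y).contDiffAt (Metric.isOpen_ball.mem_nhds hβ)).differentiableAt
    (by norm_num)).hasFDerivAt

lemma continuousAt_score (h : M.LocalEnvelope β₀ ρ b ε K) (y : 𝒴) (hβ : β ∈ Metric.ball β₀ ρ) :
    ContinuousAt (M.score y) β := (h.hasFDerivAt_score y hβ).continuousAt

lemma continuousAt_fderiv_score (h : M.LocalEnvelope β₀ ρ b ε K) (y : 𝒴)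
    (hβ : β ∈ Metric.ball β₀ ρ) : ContinuousAt (fderiv ℝ (M.score y)) β :=
  ((h.contDiffOn_score y).continuousOn_fderiv_of_isOpen Metric.isOpen_ball (by norm_num)).continuousAt
    (Metric.isOpen_ball.mem_nhds hβ)

/-- By the common support, an observation outside of it has density zero for all parameters, and
`log f(y, ·)` is then the constant junk value `log 0 = 0`, with score zero. -/
lemma f_pos_or_forall_eq_zero (h : M.LocalEnvelope β₀ ρ b ε K) (y : 𝒴) :
    (∀ β ∈ Metric.ball β₀ ρ, 0 < M.f β y) ∨ ∀ β ∈ Metric.ball β₀ ρ, M.f β y = 0 := by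
  by_cases h0 : 0 < M.f β₀ y
  · exact .inl fun β hβ => h.support _ (h.ball_subset h.center_mem) _ (h.ball_subset hβ) y h0
  · refine .inr fun β hβ => le_antisymm (not_lt.1 fun h1 => h0 ?_) (M.nonneg_f _ (h.ball_subset hβ) y)
    exact h.support _ (h.ball_subset hβ) _ (h.ball_subset h.center_mem) y h1

lemma hasFDerivAt_f (h : M.LocalEnvelope β₀ ρ b ε K) (y : 𝒴) (hβ : β ∈ Metric.ball β₀ ρ) :
    HasFDerivAt (fun β' => M.f β' y) (M.f β y • innerSL ℝ (M.score y β)) β := by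
  rcases h.f_pos_or_forall_eq_zero y with hp | hz
  · have h1 := (hasGradientAt_iff_hasFDerivAt.1 (h.hasGradientAt_log y hβ)).exp
    rw [Real.exp_log (hp β hβ)] at h1
    refine HasFDerivAt.congr_of_eventuallyEq h1 ?_
    filter_upwards [Metric.isOpen_ball.mem_nhds hβ] with β' hβ'
    rw [Real.exp_log (hp β' hβ')]
  · rw [hz β hβ, zero_smul]
    refine (hasFDerivAt_const (0 : ℝ) β).congr_of_eventuallyEq ?_
    filter_upwards [Metric.isOpen_ball.mem_nhds hβ] with β' hβ'
    exact hz β' hβ'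

lemma continuousAt_f (h : M.LocalEnvelope β₀ ρ b ε K) (y : 𝒴) (hβ : β ∈ Metric.ball β₀ ρ) :
    ContinuousAt (fun β' => M.f β' y) β := (h.hasFDerivAt_f y hβ).continuousAt

/-- The score is bounded by `b`, so `log f` is Lipschitz on the ball. -/
lemma f_le_exp_mul (h : M.LocalEnvelope β₀ ρ b ε K) (y : 𝒴) (hβ : β ∈ Metric.ball β₀ ρ) :
    M.f β y ≤ Real.exp (b y * ρ) * M.f β₀ y := by
  rcases h.f_pos_or_forall_eq_zero y with hp | hz
  · have h1 : ‖Real.log (M.f β y) - Real.log (M.f β₀ y)‖ ≤ b y * ‖β - β₀‖ :=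
      (convex_ball β₀ ρ).norm_image_sub_le_of_norm_hasFDerivWithin_le
        (fun x hx => (hasGradientAt_iff_hasFDerivAt.1
          (h.hasGradientAt_log y hx)).hasFDerivWithinAt)
        (fun x hx => by simpa using h.norm_score_le y hx) h.center_mem hβ
    have h2 : ‖β - β₀‖ ≤ ρ := (mem_ball_iff_norm.1 hβ).le
    have h3 : Real.log (M.f β y) ≤ b y * ρ + Real.log (M.f β₀ y) := by
      have := (le_abs_self _).trans h1
      have := mul_le_mul_of_nonneg_left h2 (h.nonneg y)
      linarith
    calc M.f β y = Real.exp (Real.log (M.f β y)) := (Real.exp_log (hp β hβ)).symm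
      _ ≤ Real.exp (b y * ρ + Real.log (M.f β₀ y)) := Real.exp_le_exp.2 h3
      _ = _ := by rw [Real.exp_add, Real.exp_log (hp β₀ h.center_mem)]
  · simp [hz β hβ, hz β₀ h.center_mem]

/-! ### Measurability of the score and of its derivative -/

/-- The limit of difference quotients of measurable functions is measurable. -/
lemma measurable_of_hasFDerivAt {E F : Type*} [NormedAddCommGroup E] [NormedSpace ℝ E]
    [NormedAddCommGroup F] [NormedSpace ℝ F] [MeasurableSpace F] [BorelSpace F]
    [SecondCountableTopology F]
    {G : E → 𝒴 → F} {G' : 𝒴 → E →L[ℝ] F} {x : E} {s : Set E} (hs : s ∈ 𝓝 x)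
    (hG : ∀ x' ∈ s, Measurable (G x')) (hG' : ∀ y, HasFDerivAt (G · y) (G' y) x) (v : E) :
    Measurable fun y => G' y v := by
  have hc : Tendsto (fun n : ℕ => ‖(n : ℝ)‖) atTop atTop :=
    tendsto_norm_atTop_atTop.comp tendsto_natCast_atTop_atTop
  have hx : Tendsto (fun n : ℕ => x + (n : ℝ)⁻¹ • v) atTop (𝓝 x) := by
    simpa using tendsto_const_nhds.add
      ((tendsto_inv_atTop_nhds_zero_nat (𝕜 := ℝ)).smul_const v)
  obtain ⟨N, hN⟩ := eventually_atTop.1 (hx.eventually hs)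
  refine measurable_of_tendsto_metrizable
    (f := fun n y => ((n + N : ℕ) : ℝ) • (G (x + ((n + N : ℕ) : ℝ)⁻¹ • v) y - G x y))
    (fun n => ?_) (tendsto_pi_nhds.2 fun y => ?_)
  · exact ((hG _ (hN _ (by omega))).sub (hG _ (mem_of_mem_nhds hs))).const_smul _
  · exact ((hG' y).lim v hc).comp (tendsto_add_atTop_nat N)

lemma measurable_score (h : M.LocalEnvelope β₀ ρ b ε K) (hβ : β ∈ Metric.ball β₀ ρ) :
    Measurable fun y => M.score y β := by
  have h1 : ∀ v, Measurable fun y => (innerSL ℝ (M.score y β)) v :=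
    measurable_of_hasFDerivAt (Metric.isOpen_ball.mem_nhds hβ)
      (fun β' hβ' => (M.measurable_f β' (h.ball_subset hβ')).log)
      (fun y => hasGradientAt_iff_hasFDerivAt.1 (h.hasGradientAt_log y hβ))
  have h2 : ∀ i, Measurable fun y => M.score y β i := fun i => by
    simpa [EuclideanSpace.inner_single_right] using h1 (EuclideanSpace.single i 1)
  exact (WithLp.measurable_toLp 2 _).comp (measurable_pi_iff.2 h2)

/-- A family of linear maps on a finite-dimensional space is strongly measurable if it is so
pointwise. -/
lemma aestronglyMeasurable_clm {ι F : Type*} [Fintype ι] [DecidableEq ι]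
    [NormedAddCommGroup F] [NormedSpace ℝ F]
    {L : 𝒴 → EuclideanSpace ℝ ι →L[ℝ] F} {ν : Measure 𝒴}
    (hL : ∀ v, AEStronglyMeasurable (fun y => L y v) ν) : AEStronglyMeasurable L ν := by
  have h1 : L = fun y => ∑ i, (EuclideanSpace.proj i : EuclideanSpace ℝ ι →L[ℝ] ℝ).smulRight
      (L y (EuclideanSpace.single i 1)) := by
    funext y
    ext v
    have h2 : v = ∑ i, v i • EuclideanSpace.single i (1 : ℝ) := by
      ext j; simp [Pi.single_apply]
    conv_lhs => rw [h2]
    simp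
  rw [h1]
  refine Finset.aestronglyMeasurable_fun_sum _ fun i _ => ?_
  exact (ContinuousLinearMap.smulRightL ℝ (EuclideanSpace ℝ ι) F
    (EuclideanSpace.proj i)).continuous.comp_aestronglyMeasurable (hL _)

lemma measurable_fderiv_score_apply (h : M.LocalEnvelope β₀ ρ b ε K)
    (hβ : β ∈ Metric.ball β₀ ρ) (v : Param p q) :
    Measurable fun y => fderiv ℝ (M.score y) β v :=
  measurable_of_hasFDerivAt (G := fun β y => M.score y β) (Metric.isOpen_ball.mem_nhds hβ)
    (fun _ hβ' => h.measurable_score hβ') (fun y => h.hasFDerivAt_score y hβ) v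

lemma aestronglyMeasurable_fderiv_score (h : M.LocalEnvelope β₀ ρ b ε K)
    (hβ : β ∈ Metric.ball β₀ ρ) :
    AEStronglyMeasurable (fun y => fderiv ℝ (M.score y) β) M.ν :=
  aestronglyMeasurable_clm fun v =>
    (h.measurable_fderiv_score_apply hβ v).aestronglyMeasurable

/-! ### Integrals against densities near `β₀` -/

/-- The set `{b ≤ n + 1}` on which the envelope is bounded. These sets exhaust the sample space; on
each of them all densities with parameter in the ball are dominated by a multiple of the density at
`β₀`. -/
def trunc (b : 𝒴 → ℝ) (n : ℕ) : Set 𝒴 := {y | b y ≤ n + 1}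

/-- Bound for the integral of `b` outside of the truncation set, uniform in the parameter. -/
noncomputable def tailBound (ε K : ℝ) (n : ℕ) : ℝ := ((n : ℝ) + 1) ^ (-ε) * K

lemma tendsto_tailBound (h : M.LocalEnvelope β₀ ρ b ε K) :
    Tendsto (tailBound ε K) atTop (𝓝 0) := by
  have h1 : Tendsto (fun n : ℕ => (n : ℝ) + 1) atTop atTop :=
    tendsto_atTop_add_const_right _ _ tendsto_natCast_atTop_atTop
  unfold tailBound
  simpa [tailBound, Function.comp_def] using
    ((tendsto_rpow_neg_atTop h.exponent_pos).comp h1).mul_const K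

lemma measurableSet_trunc (h : M.LocalEnvelope β₀ ρ b ε K) (n : ℕ) : MeasurableSet (trunc b n) :=
  measurableSet_le h.measurable measurable_const

lemma integrable_envelope (h : M.LocalEnvelope β₀ ρ b ε K) (hβ : β ∈ Metric.ball β₀ ρ) :
    Integrable (fun y => b y * M.f β y) M.ν := by
  refine (h.integrable_moment β hβ).mono'
    (h.measurable.mul (M.measurable_f β (h.ball_subset hβ))).aestronglyMeasurable
    (ae_of_all _ fun y => ?_)
  have h1 := M.nonneg_f β (h.ball_subset hβ) y
  rw [Real.norm_of_nonneg (mul_nonneg (h.nonneg y) h1), mul_comm]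
  refine mul_le_mul_of_nonneg_left ?_ h1
  simpa using Real.rpow_le_rpow_of_exponent_le (h.one_le y)
    (show (1 : ℝ) ≤ 1 + ε by linarith [h.exponent_pos])

lemma integrable_of_norm_le (h : M.LocalEnvelope β₀ ρ b ε K) (hβ : β ∈ Metric.ball β₀ ρ)
    {F : Type*} [NormedAddCommGroup F] {u : 𝒴 → F} {c : ℝ}
    (hu : AEStronglyMeasurable u M.ν) (hb : ∀ y, ‖u y‖ ≤ c * (b y * M.f β y)) :
    Integrable u M.ν :=
  ((h.integrable_envelope hβ).const_mul c).mono' hu (ae_of_all _ hb)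

lemma setIntegral_compl_trunc_le (h : M.LocalEnvelope β₀ ρ b ε K) (hβ : β ∈ Metric.ball β₀ ρ)
    (n : ℕ) : ∫ y in (trunc b n)ᶜ, b y * M.f β y ∂M.ν ≤ tailBound ε K n := by
  have hn : (0 : ℝ) < n + 1 := by positivity
  have h0 : ∀ y, 0 ≤ M.f β y * b y ^ (1 + ε) := fun y =>
    mul_nonneg (M.nonneg_f β (h.ball_subset hβ) y) (Real.rpow_nonneg (h.nonneg y) _)
  calc ∫ y in (trunc b n)ᶜ, b y * M.f β y ∂M.ν
      ≤ ∫ y in (trunc b n)ᶜ, ((n : ℝ) + 1) ^ (-ε) * (M.f β y * b y ^ (1 + ε)) ∂M.ν := by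
        refine setIntegral_mono_on (h.integrable_envelope hβ).integrableOn
          ((h.integrable_moment β hβ).const_mul _).integrableOn
          (h.measurableSet_trunc n).compl fun y hy => ?_
        have hy' : (n : ℝ) + 1 < b y := by simpa [trunc] using hy
        have hby : 0 < b y := hn.trans hy'
        have h1 : (1 : ℝ) ≤ ((n : ℝ) + 1) ^ (-ε) * b y ^ ε := by
          rw [Real.rpow_neg hn.le, inv_mul_eq_div, one_le_div (Real.rpow_pos_of_pos hn _)]
          exact Real.rpow_le_rpow hn.le hy'.le h.exponent_pos.le
        rw [Real.rpow_add hby, Real.rpow_one]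
        have h2 := mul_le_mul_of_nonneg_left h1
          (mul_nonneg hby.le (M.nonneg_f β (h.ball_subset hβ) y))
        linarith
    _ ≤ ∫ y, ((n : ℝ) + 1) ^ (-ε) * (M.f β y * b y ^ (1 + ε)) ∂M.ν :=
        setIntegral_le_integral ((h.integrable_moment β hβ).const_mul _)
          (ae_of_all _ fun y => mul_nonneg (Real.rpow_nonneg hn.le _) (h0 y))
    _ ≤ tailBound ε K n := by
        rw [integral_const_mul]
        exact mul_le_mul_of_nonneg_left (h.moment_le β hβ) (Real.rpow_nonneg hn.le _)

lemma norm_integral_sub_setIntegral_trunc_le (h : M.LocalEnvelope β₀ ρ b ε K)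
    (hβ : β ∈ Metric.ball β₀ ρ) {F : Type*} [NormedAddCommGroup F] [NormedSpace ℝ F]
    {u : 𝒴 → F} {c : ℝ} (hc : 0 ≤ c)
    (hu : AEStronglyMeasurable u M.ν) (hb : ∀ y, ‖u y‖ ≤ c * (b y * M.f β y)) (n : ℕ) :
    ‖∫ y, u y ∂M.ν - ∫ y in trunc b n, u y ∂M.ν‖ ≤ c * tailBound ε K n := by
  have hi := h.integrable_of_norm_le hβ hu hb
  rw [← integral_add_compl (h.measurableSet_trunc n) hi, add_sub_cancel_left]
  calc _ ≤ ∫ y in (trunc b n)ᶜ, c * (b y * M.f β y) ∂M.ν :=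
        norm_integral_le_of_norm_le ((h.integrable_envelope hβ).const_mul c).integrableOn
          (ae_of_all _ hb)
    _ ≤ c * tailBound ε K n := by
        rw [integral_const_mul]
        exact mul_le_mul_of_nonneg_left (h.setIntegral_compl_trunc_le hβ n) hc

lemma envelope_mul_le_of_mem_trunc (h : M.LocalEnvelope β₀ ρ b ε K) (hβ : β ∈ Metric.ball β₀ ρ)
    {n : ℕ} {y : 𝒴} (hy : y ∈ trunc b n) :
    b y * M.f β y ≤ ((n + 1) * Real.exp ((n + 1) * ρ)) * M.f β₀ y := by
  have hy' : b y ≤ n + 1 := hy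
  have h0 := M.nonneg_f β₀ (h.ball_subset h.center_mem) y
  calc b y * M.f β y ≤ (n + 1) * (Real.exp (b y * ρ) * M.f β₀ y) :=
        mul_le_mul hy' (h.f_le_exp_mul y hβ) (M.nonneg_f β (h.ball_subset hβ) y) (by positivity)
    _ ≤ (n + 1) * (Real.exp ((n + 1) * ρ) * M.f β₀ y) := by
        have := h.radius_pos
        gcongr
    _ = _ := by ring

/-- Dominated convergence with respect to a moving density: the functions need only be bounded by
the envelope times the density, because the moment of order `1 + ε` makes the envelope uniformly
integrable. -/
theorem tendsto_integral (h : M.LocalEnvelope β₀ ρ b ε K) {ι F : Type*} [NormedAddCommGroup F]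
    [NormedSpace ℝ F] {l : Filter ι} [l.IsCountablyGenerated]
    {π : ι → Param p q} (hπ : ∀ᶠ i in l, π i ∈ Metric.ball β₀ ρ) {u : ι → 𝒴 → F} {v : 𝒴 → F}
    {c : ℝ} (hc : 0 ≤ c) (hu : ∀ᶠ i in l, AEStronglyMeasurable (u i) M.ν)
    (hub : ∀ᶠ i in l, ∀ y, ‖u i y‖ ≤ c * (b y * M.f (π i) y))
    (hv : AEStronglyMeasurable v M.ν) (hvb : ∀ y, ‖v y‖ ≤ c * (b y * M.f β₀ y))
    (hlim : ∀ y, Tendsto (fun i => u i y) l (𝓝 (v y))) :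
    Tendsto (fun i => ∫ y, u i y ∂M.ν) l (𝓝 (∫ y, v y ∂M.ν)) := by
  have htail : Tendsto (fun n => c * tailBound ε K n) atTop (𝓝 0) := by
    simpa using h.tendsto_tailBound.const_mul c
  have h1 : TendstoUniformlyOnFilter (fun n i => ∫ y in trunc b n, u i y ∂M.ν)
      (fun i => ∫ y, u i y ∂M.ν) atTop l := by
    rw [Metric.tendstoUniformlyOnFilter_iff]
    intro η hη
    filter_upwards [(htail.eventually (gt_mem_nhds hη)).prod_mk (hπ.and (hu.and hub))]
      with x hx
    rw [dist_eq_norm]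
    exact (h.norm_integral_sub_setIntegral_trunc_le hx.2.1 hc hx.2.2.1 hx.2.2.2 _).trans_lt hx.1
  refine h1.tendsto_of_eventually_tendsto (L := fun n => ∫ y in trunc b n, v y ∂M.ν)
    (.of_forall fun n => ?_) ?_
  · refine tendsto_integral_filter_of_dominated_convergence
      (fun y => c * (((n + 1) * Real.exp ((n + 1) * ρ)) * M.f β₀ y))
      (hu.mono fun i hi => hi.restrict) ?_ ?_ (ae_of_all _ hlim)
    · filter_upwards [hπ, hub] with i hi hb
      filter_upwards [ae_restrict_mem (h.measurableSet_trunc n)] with y hy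
      exact (hb y).trans (mul_le_mul_of_nonneg_left (h.envelope_mul_le_of_mem_trunc hi hy) hc)
    · exact (((integrable_f (h.ball_subset h.center_mem)).const_mul _).const_mul _).integrableOn
  · rw [tendsto_iff_norm_sub_tendsto_zero]
    refine squeeze_zero (fun _ => norm_nonneg _) (fun n => ?_) htail
    rw [norm_sub_rev]
    exact h.norm_integral_sub_setIntegral_trunc_le h.center_mem hc hv hvb n

/-- Differentiation under the integral sign when function and derivative are bounded by the
envelope times a density that moves with the argument. -/
theorem hasFDerivAt_integral (h : M.LocalEnvelope β₀ ρ b ε K) {E F : Type*}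
    [NormedAddCommGroup E] [NormedSpace ℝ E] [NormedAddCommGroup F] [NormedSpace ℝ F]
    {s : Set E} (hs : IsOpen s) {π : E → Param p q} (hπ : ∀ x ∈ s, π x ∈ Metric.ball β₀ ρ)
    {G : E → 𝒴 → F} {G' : E → 𝒴 → E →L[ℝ] F} {c : ℝ} (hc : 0 ≤ c)
    (hG : ∀ x ∈ s, AEStronglyMeasurable (G x) M.ν)
    (hGb : ∀ x ∈ s, ∀ y, ‖G x y‖ ≤ c * (b y * M.f (π x) y))
    (hG' : ∀ x ∈ s, AEStronglyMeasurable (G' x) M.ν)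
    (hGb' : ∀ x ∈ s, ∀ y, ‖G' x y‖ ≤ c * (b y * M.f (π x) y))
    (hd : ∀ x ∈ s, ∀ y, HasFDerivAt (G · y) (G' x y) x) {x : E} (hx : x ∈ s) :
    HasFDerivAt (fun x => ∫ y, G x y ∂M.ν) (∫ y, G' x y ∂M.ν) x := by
  have htail : Tendsto (fun n => c * tailBound ε K n) atTop (𝓝 0) := by
    simpa using h.tendsto_tailBound.const_mul c
  refine hasFDerivAt_of_tendstoUniformlyOn (l := atTop) (g' := fun x => ∫ y, G' x y ∂M.ν)
    (f := fun n x => ∫ y in trunc b n, G x y ∂M.ν)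
    (f' := fun n x => ∫ y in trunc b n, G' x y ∂M.ν) hs ?_ ?_ ?_ hx
  · rw [Metric.tendstoUniformlyOn_iff]
    intro η hη
    filter_upwards [htail.eventually (gt_mem_nhds hη)] with n hn x hx
    rw [dist_eq_norm]
    exact (h.norm_integral_sub_setIntegral_trunc_le (hπ x hx) hc (hG' x hx) (hGb' x hx) _).trans_lt
      hn
  · intro n x hx
    refine hasFDerivAt_integral_of_dominated_of_fderiv_le (hs.mem_nhds hx)
      (bound := fun y => c * (((n + 1) * Real.exp ((n + 1) * ρ)) * M.f β₀ y))
      (eventually_of_mem (hs.mem_nhds hx) fun x hx => (hG x hx).restrict)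
      (h.integrable_of_norm_le (hπ x hx) (hG x hx) (hGb x hx)).integrableOn (hG' x hx).restrict
      ?_ ?_ (ae_of_all _ fun y x hx => hd x hx y)
    · filter_upwards [ae_restrict_mem (h.measurableSet_trunc n)] with y hy x hx
      exact (hGb' x hx y).trans
        (mul_le_mul_of_nonneg_left (h.envelope_mul_le_of_mem_trunc (hπ x hx) hy) hc)
    · exact (((integrable_f (h.ball_subset h.center_mem)).const_mul _).const_mul _).integrableOn
  · intro x hx
    rw [tendsto_iff_norm_sub_tendsto_zero]
    refine squeeze_zero (fun _ => norm_nonneg _) (fun n => ?_) htail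
    rw [norm_sub_rev]
    exact h.norm_integral_sub_setIntegral_trunc_le (hπ x hx) hc (hG x hx) (hGb x hx) n

end LocalEnvelope

end ParametricModel

namespace ParametricModel

variable {p q : ℕ} {𝒴 : Type*} [MeasurableSpace 𝒴] {M : ParametricModel p q 𝒴}

/-! ### The expected score as a function of the true and of the model parameter -/

/-- The expected score `E_β S(Y, b)` of the full model as a function of the pair `(β, b)` of the
true parameter and the model parameter. -/
noncomputable def meanScore (M : ParametricModel p q 𝒴) (x : Param p q × Param p q) : Param p q :=
  ∫ y, M.f x.1 y • M.score y x.2 ∂M.ν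

/-- The linear map `(v, w) ↦ A w + ⟪s, v⟫ t`, which the product rule produces. -/
noncomputable def productRuleMap {E : Type*} [NormedAddCommGroup E] [InnerProductSpace ℝ E]
    (z : (E →L[ℝ] E) × E × E) : E × E →L[ℝ] E :=
  z.1 ∘L ContinuousLinearMap.snd ℝ E E +
    (innerSL ℝ z.2.1 ∘L ContinuousLinearMap.fst ℝ E E).smulRight z.2.2

lemma productRuleMap_apply {E : Type*} [NormedAddCommGroup E] [InnerProductSpace ℝ E]
    (z : (E →L[ℝ] E) × E × E) (v : E × E) :
    productRuleMap z v = z.1 v.2 + inner ℝ z.2.1 v.1 • z.2.2 := by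
  simp [productRuleMap]

lemma continuous_productRuleMap {E : Type*} [NormedAddCommGroup E] [InnerProductSpace ℝ E] :
    Continuous (productRuleMap (E := E)) := by
  have h1 : Continuous fun z : (E →L[ℝ] E) × E × E =>
      innerSL ℝ z.2.1 ∘L ContinuousLinearMap.fst ℝ E E :=
    ((innerSL ℝ).continuous.comp (continuous_fst.comp continuous_snd)).clm_comp continuous_const
  refine (continuous_fst.clm_comp continuous_const).add ?_
  exact ((ContinuousLinearMap.smulRightL ℝ (E × E) E).continuous.comp h1).clm_apply
    (continuous_snd.comp continuous_snd)

lemma norm_productRuleMap_le {E : Type*} [NormedAddCommGroup E] [InnerProductSpace ℝ E]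
    (z : (E →L[ℝ] E) × E × E) : ‖productRuleMap z‖ ≤ ‖z.1‖ + ‖z.2.1‖ * ‖z.2.2‖ := by
  refine ContinuousLinearMap.opNorm_le_bound _ (by positivity) fun v => ?_
  rw [productRuleMap_apply, add_mul]
  refine (norm_add_le _ _).trans (add_le_add ?_ ?_)
  · exact (z.1.le_opNorm _).trans (mul_le_mul_of_nonneg_left (norm_snd_le v) (norm_nonneg _))
  · rw [norm_smul, mul_right_comm]
    refine mul_le_mul_of_nonneg_right ?_ (norm_nonneg _)
    exact (norm_inner_le_norm _ _).trans
      (mul_le_mul_of_nonneg_left (norm_fst_le v) (norm_nonneg _))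

/-- The derivative of `f(y, β) S(y, b)` with respect to `(β, b)`. -/
noncomputable def weightedScoreDeriv (M : ParametricModel p q 𝒴) (x : Param p q × Param p q)
    (y : 𝒴) : Param p q × Param p q →L[ℝ] Param p q :=
  M.f x.1 y • productRuleMap (fderiv ℝ (M.score y) x.2, M.score y x.1, M.score y x.2)

/-- The derivative of the expected score. -/
noncomputable def meanScoreDeriv (M : ParametricModel p q 𝒴) (x : Param p q × Param p q) :
    Param p q × Param p q →L[ℝ] Param p q :=
  ∫ y, M.weightedScoreDeriv x y ∂M.ν

@[simp]
lemma weightedScoreDeriv_apply (x : Param p q × Param p q) (y : 𝒴) (v : Param p q × Param p q) :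
    M.weightedScoreDeriv x y v = M.f x.1 y • (fderiv ℝ (M.score y) x.2 v.2 +
      inner ℝ (M.score y x.1) v.1 • M.score y x.2) := by
  simp [weightedScoreDeriv, productRuleMap_apply]

namespace LocalEnvelope

variable {β₀ β β' : Param p q} {ρ ε K : ℝ} {b : 𝒴 → ℝ}

lemma norm_score_mul_norm_score_le (h : M.LocalEnvelope β₀ ρ b ε K) (y : 𝒴)
    (hβ : β ∈ Metric.ball β₀ ρ) (hβ' : β' ∈ Metric.ball β₀ ρ) :
    ‖M.score y β‖ * ‖M.score y β'‖ ≤ b y := by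
  have h1 := h.norm_score_sq_le y β hβ
  have h2 := h.norm_score_sq_le y β' hβ'
  nlinarith [sq_nonneg (‖M.score y β‖ - ‖M.score y β'‖)]

lemma norm_f_smul_le (h : M.LocalEnvelope β₀ ρ b ε K) (hβ : β ∈ Metric.ball β₀ ρ) (y : 𝒴)
    {F : Type*} [NormedAddCommGroup F] [NormedSpace ℝ F] {u : F} {c : ℝ} (hu : ‖u‖ ≤ c * b y) :
    ‖M.f β y • u‖ ≤ c * (b y * M.f β y) := by
  have h1 := M.nonneg_f β (h.ball_subset hβ) y
  rw [norm_smul, Real.norm_of_nonneg h1]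
  nlinarith

lemma aestronglyMeasurable_f (h : M.LocalEnvelope β₀ ρ b ε K) (hβ : β ∈ Metric.ball β₀ ρ) :
    AEStronglyMeasurable (M.f β) M.ν :=
  (M.measurable_f β (h.ball_subset hβ)).aestronglyMeasurable

lemma aestronglyMeasurable_score (h : M.LocalEnvelope β₀ ρ b ε K) (hβ : β ∈ Metric.ball β₀ ρ) :
    AEStronglyMeasurable (fun y => M.score y β) M.ν :=
  (h.measurable_score hβ).aestronglyMeasurable

lemma aestronglyMeasurable_weightedScoreDeriv (h : M.LocalEnvelope β₀ ρ b ε K)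
    (hβ : β ∈ Metric.ball β₀ ρ) (hβ' : β' ∈ Metric.ball β₀ ρ) :
    AEStronglyMeasurable (M.weightedScoreDeriv (β, β')) M.ν := by
  exact (h.aestronglyMeasurable_f hβ).smul (continuous_productRuleMap.comp_aestronglyMeasurable
    ((h.aestronglyMeasurable_fderiv_score hβ').prodMk
      ((h.aestronglyMeasurable_score hβ).prodMk (h.aestronglyMeasurable_score hβ'))))

lemma norm_weightedScoreDeriv_le (h : M.LocalEnvelope β₀ ρ b ε K)
    (hβ : β ∈ Metric.ball β₀ ρ) (hβ' : β' ∈ Metric.ball β₀ ρ) (y : 𝒴) :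
    ‖M.weightedScoreDeriv (β, β') y‖ ≤ 2 * (b y * M.f β y) := by
  rw [weightedScoreDeriv]
  refine h.norm_f_smul_le (F := Param p q × Param p q →L[ℝ] Param p q) hβ y ?_
  rw [two_mul]
  exact (norm_productRuleMap_le _).trans (add_le_add (h.norm_fderiv_score_le y β' hβ')
    (h.norm_score_mul_norm_score_le y hβ hβ'))

lemma integrable_weightedScoreDeriv (h : M.LocalEnvelope β₀ ρ b ε K)
    (hβ : β ∈ Metric.ball β₀ ρ) (hβ' : β' ∈ Metric.ball β₀ ρ) :
    Integrable (M.weightedScoreDeriv (β, β')) M.ν :=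
  h.integrable_of_norm_le hβ (h.aestronglyMeasurable_weightedScoreDeriv hβ hβ')
    (h.norm_weightedScoreDeriv_le hβ hβ')

lemma hasFDerivAt_meanScore (h : M.LocalEnvelope β₀ ρ b ε K) {x : Param p q × Param p q}
    (hx : x ∈ Metric.ball β₀ ρ ×ˢ Metric.ball β₀ ρ) :
    HasFDerivAt M.meanScore (M.meanScoreDeriv x) x := by
  refine h.hasFDerivAt_integral (s := Metric.ball β₀ ρ ×ˢ Metric.ball β₀ ρ)
    (Metric.isOpen_ball.prod Metric.isOpen_ball)
    (π := Prod.fst) (fun x hx => hx.1) (c := 2) (by norm_num) (G' := M.weightedScoreDeriv)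
    (G := fun x y => M.f x.1 y • M.score y x.2)
    (fun x hx => (h.aestronglyMeasurable_f hx.1).smul (h.aestronglyMeasurable_score hx.2))
    (fun x hx y => h.norm_f_smul_le hx.1 y
      ((h.norm_score_le y hx.2).trans (by linarith [h.nonneg y])))
    (fun x hx => h.aestronglyMeasurable_weightedScoreDeriv hx.1 hx.2)
    (fun x hx => h.norm_weightedScoreDeriv_le hx.1 hx.2) (fun x hx y => ?_) hx
  have h1 : HasFDerivAt (fun x : Param p q × Param p q => M.f x.1 y)
      ((M.f x.1 y • innerSL ℝ (M.score y x.1)) ∘L ContinuousLinearMap.fst ℝ _ _) x :=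
    (h.hasFDerivAt_f y hx.1).comp x hasFDerivAt_fst
  have h2 : HasFDerivAt (fun x : Param p q × Param p q => M.score y x.2)
      (fderiv ℝ (M.score y) x.2 ∘L ContinuousLinearMap.snd ℝ _ _) x :=
    (h.hasFDerivAt_score y hx.2).comp x hasFDerivAt_snd
  refine (h1.smul h2).congr_fderiv ?_
  refine ContinuousLinearMap.ext fun v => ?_
  simp [smul_smul]

lemma continuousAt_weightedScoreDeriv (h : M.LocalEnvelope β₀ ρ b ε K) (y : 𝒴) :
    ContinuousAt (fun x => M.weightedScoreDeriv x y) (β₀, β₀) := by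
  have t1 : Tendsto (Prod.fst : Param p q × Param p q → Param p q) (𝓝 (β₀, β₀)) (𝓝 β₀) :=
    continuous_fst.tendsto _
  have t2 : Tendsto (Prod.snd : Param p q × Param p q → Param p q) (𝓝 (β₀, β₀)) (𝓝 β₀) :=
    continuous_snd.tendsto _
  have h1 := (h.continuousAt_f y h.center_mem).tendsto.comp t1
  have h2 := (h.continuousAt_score y h.center_mem).tendsto.comp t1
  have h3 := (h.continuousAt_score y h.center_mem).tendsto.comp t2
  have h4 := (h.continuousAt_fderiv_score y h.center_mem).tendsto.comp t2
  have h5 := h4.prodMk_nhds (h2.prodMk_nhds h3)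
  have h6 := ((continuous_productRuleMap (E := Param p q)).tendsto _).comp h5
  exact h1.smul h6

lemma continuousAt_meanScoreDeriv (h : M.LocalEnvelope β₀ ρ b ε K) :
    ContinuousAt M.meanScoreDeriv (β₀, β₀) := by
  have hmem : ∀ᶠ x : Param p q × Param p q in 𝓝 (β₀, β₀),
      x ∈ Metric.ball β₀ ρ ×ˢ Metric.ball β₀ ρ :=
    (Metric.isOpen_ball.prod Metric.isOpen_ball).mem_nhds ⟨h.center_mem, h.center_mem⟩
  have hu : ∀ᶠ x : Param p q × Param p q in 𝓝 (β₀, β₀),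
      AEStronglyMeasurable (M.weightedScoreDeriv x) M.ν :=
    hmem.mono fun x hx => h.aestronglyMeasurable_weightedScoreDeriv hx.1 hx.2
  have hub : ∀ᶠ x : Param p q × Param p q in 𝓝 (β₀, β₀),
      ∀ y, ‖M.weightedScoreDeriv x y‖ ≤ 2 * (b y * M.f x.1 y) :=
    hmem.mono fun x hx => h.norm_weightedScoreDeriv_le hx.1 hx.2
  exact h.tendsto_integral (hmem.mono fun x hx => hx.1) zero_le_two hu hub
    (h.aestronglyMeasurable_weightedScoreDeriv h.center_mem h.center_mem)
    (h.norm_weightedScoreDeriv_le h.center_mem h.center_mem)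
    fun y => h.continuousAt_weightedScoreDeriv y

lemma hasStrictFDerivAt_meanScore (h : M.LocalEnvelope β₀ ρ b ε K) :
    HasStrictFDerivAt M.meanScore (M.meanScoreDeriv (β₀, β₀)) (β₀, β₀) :=
  hasStrictFDerivAt_of_hasFDerivAt_of_continuousAt
    (eventually_of_mem ((Metric.isOpen_ball.prod Metric.isOpen_ball).mem_nhds
      ⟨h.center_mem, h.center_mem⟩) fun _ hx => h.hasFDerivAt_meanScore hx)
    h.continuousAt_meanScoreDeriv

/-! ### The score identities -/

/-- The score has mean zero: the derivative of the constant `∫ f(y, β) dy = 1`. -/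
lemma meanScore_diag (h : M.LocalEnvelope β₀ ρ b ε K) (hβ : β ∈ Metric.ball β₀ ρ) :
    M.meanScore (β, β) = 0 := by
  have hb1 : ∀ β ∈ Metric.ball β₀ ρ, ∀ y, ‖M.f β y‖ ≤ 1 * (b y * M.f β y) := fun β hβ y => by
    simpa using h.norm_f_smul_le hβ y (u := (1 : ℝ)) (c := 1) (by simpa using h.one_le y)
  have hsm : ∀ β ∈ Metric.ball β₀ ρ, AEStronglyMeasurable (fun y => M.f β y • M.score y β) M.ν :=
    fun β hβ => (h.aestronglyMeasurable_f hβ).smul (h.aestronglyMeasurable_score hβ)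
  have heq : ∀ β y, M.f β y • innerSL ℝ (M.score y β) = innerSL ℝ (M.f β y • M.score y β) :=
    fun β y => by simp
  have hsb : ∀ β ∈ Metric.ball β₀ ρ, ∀ y, ‖M.f β y • M.score y β‖ ≤ 1 * (b y * M.f β y) :=
    fun β hβ y => h.norm_f_smul_le hβ y (by simpa using h.norm_score_le y hβ)
  have h1 := h.hasFDerivAt_integral (s := Metric.ball β₀ ρ) Metric.isOpen_ball (π := id)
    (fun x hx => hx) (c := 1) zero_le_one (G := fun β y => M.f β y)
    (G' := fun β y => innerSL ℝ (M.f β y • M.score y β))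
    (fun β hβ => h.aestronglyMeasurable_f hβ) hb1
    (fun β hβ => (innerSL ℝ).continuous.comp_aestronglyMeasurable (hsm β hβ))
    (fun β hβ y => by rw [innerSL_apply_norm]; exact hsb β hβ y)
    (fun β hβ y => heq β y ▸ h.hasFDerivAt_f y hβ) hβ
  have h2 : HasFDerivAt (fun β => ∫ y, M.f β y ∂M.ν) (0 : Param p q →L[ℝ] ℝ) β := by
    refine (hasFDerivAt_const (1 : ℝ) β).congr_of_eventuallyEq ?_
    filter_upwards [Metric.isOpen_ball.mem_nhds hβ] with β' hβ'
    exact integral_f (h.ball_subset hβ')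
  have h3 := h1.unique h2
  have h4 := (innerSL ℝ (E := Param p q)).integral_comp_comm
    (h.integrable_of_norm_le hβ (hsm β hβ) (hsb β hβ))
  rw [h3] at h4
  have h5 : ‖innerSL ℝ (M.meanScore (β, β))‖ = 0 := by
    rw [meanScore, ← h4, norm_zero]
  rwa [innerSL_apply_norm, norm_eq_zero] at h5

lemma integral_score_law (β : M.par) (β' : Param p q) :
    ∫ y, M.score y β' ∂(M.law β) = M.meanScore (β, β') := integral_law β _

lemma integrable_score_law (h : M.LocalEnvelope β₀ ρ b ε K) {β : M.par}
    (hβ : (β : Param p q) ∈ Metric.ball β₀ ρ) (hβ' : β' ∈ Metric.ball β₀ ρ) :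
    Integrable (fun y => M.score y β') (M.law β) := by
  rw [integrable_law_iff]
  exact h.integrable_of_norm_le hβ (c := 1)
    ((h.aestronglyMeasurable_f hβ).smul (h.aestronglyMeasurable_score hβ'))
    (fun y => h.norm_f_smul_le hβ y (by simpa using h.norm_score_le y hβ'))

lemma integrable_envelope_law (h : M.LocalEnvelope β₀ ρ b ε K) {β : M.par}
    (hβ : (β : Param p q) ∈ Metric.ball β₀ ρ) : Integrable b (M.law β) := by
  rw [integrable_law_iff]
  simpa [mul_comm] using h.integrable_envelope hβ

lemma memLp_score_law (h : M.LocalEnvelope β₀ ρ b ε K) {β : M.par}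
    (hβ : (β : Param p q) ∈ Metric.ball β₀ ρ) (hβ' : β' ∈ Metric.ball β₀ ρ) :
    MemLp (fun y => M.score y β') 2 (M.law β) := by
  rw [memLp_two_iff_integrable_sq_norm (h.measurable_score hβ').aestronglyMeasurable]
  exact (h.integrable_envelope_law hβ).mono'
    ((h.measurable_score hβ').norm.pow_const 2).aestronglyMeasurable
    (ae_of_all _ fun y => by simpa using h.norm_score_sq_le y β' hβ')

end LocalEnvelope

variable {β₀ : M.par} {ρ ε K : ℝ} {b : 𝒴 → ℝ}

namespace LocalEnvelope

lemma fisher_eq_integral (h : M.LocalEnvelope β₀ ρ b ε K) (i j : Fin p ⊕ Fin q) :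
    M.fisher β₀ i j = ∫ y, M.score y β₀ i * M.score y β₀ j ∂(M.law β₀) := by
  have h2 := h.memLp_score_law h.center_mem h.center_mem
  have h3 : ∀ i, MemLp (fun y => M.score y β₀ i) 2 (M.law β₀) := fun i =>
    (EuclideanSpace.proj i : Param p q →L[ℝ] ℝ).comp_memLp' h2
  have h4 : ∀ i, ∫ y, M.score y β₀ i ∂(M.law β₀) = 0 := fun i => by
    have := (EuclideanSpace.proj i : Param p q →L[ℝ] ℝ).integral_comp_comm
      (h.integrable_score_law h.center_mem h.center_mem)
    rw [integral_score_law, h.meanScore_diag h.center_mem] at this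
    simpa using this
  simp only [fisher, Matrix.of_apply]
  rw [covariance_eq_sub (h3 i) (h3 j), h4, zero_mul, sub_zero]
  rfl

lemma meanScoreDeriv_inl (h : M.LocalEnvelope β₀ ρ b ε K) (v : Param p q) :
    M.meanScoreDeriv (β₀, β₀) (v, 0) = Matrix.toEuclideanCLM (𝕜 := ℝ) (M.fisher β₀) v := by
  ext i
  have h1 := h.integrable_weightedScoreDeriv h.center_mem h.center_mem
  have hs := h.memLp_score_law h.center_mem h.center_mem
  have hsi : ∀ i, MemLp (fun y => M.score y β₀ i) 2 (M.law β₀) := fun i =>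
    (EuclideanSpace.proj i : Param p q →L[ℝ] ℝ).comp_memLp' hs
  have h2 := (EuclideanSpace.proj i : Param p q →L[ℝ] ℝ).integral_comp_comm
    (h1.apply_continuousLinearMap (v, 0))
  rw [← ContinuousLinearMap.integral_apply h1] at h2
  change _ = M.meanScoreDeriv (β₀, β₀) (v, 0) i at h2
  rw [← h2, Matrix.ofLp_toEuclideanCLM, Matrix.mulVec, dotProduct]
  simp_rw [h.fisher_eq_integral, ← integral_mul_const]
  rw [← integral_finsetSum Finset.univ (f := fun j y => M.score y β₀ i * M.score y β₀ j * v j)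
    fun j _ => ((hsi i).integrable_mul (hsi j)).mul_const _, integral_law]
  congr 1
  funext y
  rw [M.weightedScoreDeriv_apply]
  simp only [map_zero, zero_add, map_smul, PiLp.proj_apply, smul_eq_mul, PiLp.inner_apply,
    Finset.sum_mul]
  congr 1
  exact Finset.sum_congr rfl fun j _ => by simp; ring

/-- Since `E_β S(Y, β) = 0` for all `β`, the two partial derivatives of the expected score at
`(β₀, β₀)` are opposite to each other; this is the information identity. -/
lemma meanScoreDeriv_center (h : M.LocalEnvelope β₀ ρ b ε K) (v w : Param p q) :
    M.meanScoreDeriv (β₀, β₀) (v, w) = Matrix.toEuclideanCLM (𝕜 := ℝ) (M.fisher β₀) (v - w) := by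
  have h1 : HasFDerivAt (fun β : Param p q => M.meanScore (β, β))
      (M.meanScoreDeriv (β₀, β₀) ∘L (ContinuousLinearMap.id ℝ _).prod (ContinuousLinearMap.id ℝ _))
      β₀ :=
    HasFDerivAt.comp (β₀ : Param p q) (g := M.meanScore) (f := fun β : Param p q => (β, β))
      (h.hasFDerivAt_meanScore (x := ((β₀ : Param p q), (β₀ : Param p q)))
        ⟨h.center_mem, h.center_mem⟩)
      ((hasFDerivAt_id _).prodMk (hasFDerivAt_id _))
  have h2 : HasFDerivAt (fun β : Param p q => M.meanScore (β, β)) (0 : Param p q →L[ℝ] Param p q)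
      β₀ := by
    refine (hasFDerivAt_const (0 : Param p q) (β₀ : Param p q)).congr_of_eventuallyEq ?_
    filter_upwards [Metric.isOpen_ball.mem_nhds h.center_mem] with β' hβ'
    exact h.meanScore_diag hβ'
  have h3 : M.meanScoreDeriv (β₀, β₀) (w, w) = 0 := by
    simpa using DFunLike.congr_fun (h1.unique h2) w
  have h4 : (v, w) = (v - w, 0) + (w, w) := by simp
  rw [h4, map_add, h3, add_zero, h.meanScoreDeriv_inl]

end LocalEnvelope

end ParametricModel

/-! ### Candidate models as coordinate subspaces -/

section Coordinates

variable {p q : ℕ} {k : Finset (Fin q)}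

lemma incl_injective (p : ℕ) {q : ℕ} (k : Finset (Fin q)) : Function.Injective (incl p k) :=
  Function.injective_id.sumMap Subtype.val_injective

/-- The restriction to the coordinates of the candidate model as a continuous linear map. -/
noncomputable def restrictCLM (p : ℕ) {q : ℕ} (k : Finset (Fin q)) :
    Param p q →L[ℝ] SubParam p k :=
  LinearMap.toContinuousLinearMap
    { toFun := restrict k
      map_add' := fun _ _ => rfl
      map_smul' := fun _ _ => rfl }

/-- Extension of a parameter of the candidate model by zero. -/
noncomputable def embedCLM (p : ℕ) {q : ℕ} (k : Finset (Fin q)) :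
    SubParam p k →L[ℝ] Param p q :=
  LinearMap.toContinuousLinearMap
    { toFun := augment 0 k
      map_add' := fun x y => by
        ext i
        rcases i with i | j
        · simp [augment]
        · by_cases hj : j ∈ k <;> simp [augment, hj]
      map_smul' := fun c x => by
        ext i
        rcases i with i | j
        · simp [augment]
        · by_cases hj : j ∈ k <;> simp [augment, hj] }

@[simp]
lemma restrict_apply (v : Param p q) (i : Fin p ⊕ k) : restrict k v i = v (incl p k i) := rfl

@[simp]
lemma restrictCLM_ofLp (v : Param p q) (i : Fin p ⊕ k) :
    restrictCLM p k v i = v (incl p k i) := rfl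

lemma embedCLM_apply (b : SubParam p k) : embedCLM p k b = augment 0 k b := rfl

@[simp]
lemma augment_incl (β₀ : Param p q) (b : SubParam p k) (i : Fin p ⊕ k) :
    augment β₀ k b (incl p k i) = b i := by
  rcases i with i | ⟨j, hj⟩
  · simp [augment, incl]
  · simp [augment, incl, hj]

lemma augment_inr_of_notMem (β₀ : Param p q) (b : SubParam p k) {j : Fin q} (hj : j ∉ k) :
    augment β₀ k b (Sum.inr j) = β₀ (Sum.inr j) := by
  simp [augment, hj]

/-- Two parameters agree if they do on the coordinates of the candidate model and on the others. -/
lemma param_ext {v w : Param p q} (h1 : ∀ i, v (incl p k i) = w (incl p k i))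
    (h2 : ∀ j ∉ k, v (Sum.inr j) = w (Sum.inr j)) : v = w := by
  ext i
  rcases i with i | j
  · exact h1 (Sum.inl i)
  · by_cases hj : j ∈ k
    · exact h1 (Sum.inr ⟨j, hj⟩)
    · exact h2 j hj

lemma augment_eq (β₀ : Param p q) (b : SubParam p k) :
    augment β₀ k b = β₀ + embedCLM p k (b - restrict k β₀) := by
  refine param_ext (k := k) (fun i => ?_) (fun j hj => ?_)
  · simp [embedCLM_apply]
  · simp [embedCLM_apply, augment_inr_of_notMem, hj]

lemma augment_restrict (β₀ : Param p q) : augment β₀ k (restrict k β₀) = β₀ := by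
  simp [augment_eq]

lemma sum_mul_embedCLM (u : Fin p ⊕ Fin q → ℝ) (b : SubParam p k) :
    ∑ i, u i * embedCLM p k b i = ∑ i, u (incl p k i) * b i := by
  refine (Finset.sum_of_injOn (incl p k) (incl_injective p k).injOn (by simp) ?_ ?_).symm
  · intro i _ hi
    rcases i with i | j
    · exact absurd ⟨Sum.inl i, by simp, rfl⟩ hi
    · have hj : j ∉ k := fun hj => hi ⟨Sum.inr ⟨j, hj⟩, by simp, rfl⟩
      simp [embedCLM_apply, augment_inr_of_notMem, hj]
  · intro i _
    simp [embedCLM_apply]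

lemma inner_embedCLM (v : Param p q) (b : SubParam p k) :
    inner ℝ v (embedCLM p k b) = inner ℝ (restrictCLM p k v) b := by
  have := sum_mul_embedCLM v b
  simpa only [PiLp.inner_apply, RCLike.inner_apply, conj_trivial, mul_comm, restrictCLM_ofLp]
    using this

lemma hasStrictFDerivAt_augment (β₀ : Param p q) (b : SubParam p k) :
    HasStrictFDerivAt (augment β₀ k) (embedCLM p k) b := by
  have h1 : augment β₀ k = fun b => embedCLM p k b + (β₀ - embedCLM p k (restrict k β₀)) := by
    funext b
    rw [augment_eq, map_sub]
    abel
  rw [h1]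
  exact (embedCLM p k).hasStrictFDerivAt.add_const _

lemma continuous_augment (β₀ : Param p q) : Continuous (augment β₀ k) :=
  continuous_iff_continuousAt.2 fun b => (hasStrictFDerivAt_augment β₀ b).continuousAt

lemma toEuclideanCLM_submatrix (A : Matrix (Fin p ⊕ Fin q) (Fin p ⊕ Fin q) ℝ) :
    Matrix.toEuclideanCLM (𝕜 := ℝ) (A.submatrix (incl p k) (incl p k)) =
      restrictCLM p k ∘L Matrix.toEuclideanCLM (𝕜 := ℝ) A ∘L embedCLM p k := by
  refine ContinuousLinearMap.ext fun b => ?_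
  ext i
  have := sum_mul_embedCLM (A (incl p k i)) b
  simpa [Matrix.ofLp_toEuclideanCLM, Matrix.mulVec, dotProduct] using this.symm

end Coordinates

namespace ParametricModel

variable {p q : ℕ} {𝒴 : Type*} [MeasurableSpace 𝒴] {M : ParametricModel p q 𝒴}
  {k : Finset (Fin q)}

lemma Regular.isUnit_det_subFisher {β₀ : M.par} (hreg : M.Regular β₀)
    (k : Finset (Fin q)) : IsUnit (M.subFisher β₀ k).det :=
  isUnit_iff_ne_zero.2 (hreg.posDef.submatrix (incl_injective p k)).det_pos.ne'

namespace LocalEnvelope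

section

variable {β₀ : Param p q} {ρ ε K : ℝ} {b : 𝒴 → ℝ}

lemma subScore_eq (h : M.LocalEnvelope β₀ ρ b ε K) (y : 𝒴) {x : SubParam p k}
    (hx : augment β₀ k x ∈ Metric.ball β₀ ρ) :
    M.subScore β₀ k y x = restrictCLM p k (M.score y (augment β₀ k x)) := by
  refine HasGradientAt.gradient ?_
  rw [hasGradientAt_iff_hasFDerivAt]
  have h1 := (hasGradientAt_iff_hasFDerivAt.1 (h.hasGradientAt_log y hx)).comp x
    (hasStrictFDerivAt_augment β₀ x).hasFDerivAt
  refine h1.congr_fderiv ?_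
  refine ContinuousLinearMap.ext fun v => ?_
  simp [inner_embedCLM]

lemma subHessian_eq (h : M.LocalEnvelope β₀ ρ b ε K) (y : 𝒴) {x : SubParam p k}
    (hx : augment β₀ k x ∈ Metric.ball β₀ ρ) (i j : Fin p ⊕ k) :
    M.subHessian β₀ k y x i j = fderiv ℝ (M.score y) (augment β₀ k x)
      (embedCLM p k (EuclideanSpace.single j 1)) (incl p k i) := by
  have h1 : HasFDerivAt (fun x => restrictCLM p k (M.score y (augment β₀ k x)) i)
      ((EuclideanSpace.proj i : SubParam p k →L[ℝ] ℝ) ∘L restrictCLM p k ∘L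
        fderiv ℝ (M.score y) (augment β₀ k x) ∘L embedCLM p k) x :=
    (EuclideanSpace.proj i : SubParam p k →L[ℝ] ℝ).hasFDerivAt.comp x
      ((restrictCLM p k).hasFDerivAt.comp x
        ((h.hasFDerivAt_score y hx).comp x (hasStrictFDerivAt_augment β₀ x).hasFDerivAt))
  have h2 : (fun x => M.subScore β₀ k y x i) =ᶠ[𝓝 x]
      fun x => restrictCLM p k (M.score y (augment β₀ k x)) i := by
    filter_upwards [(continuous_augment β₀).continuousAt (Metric.isOpen_ball.mem_nhds hx)]
      with x' hx'
    rw [h.subScore_eq y hx']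
  simp only [subHessian, Matrix.of_apply]
  rw [(h1.congr_of_eventuallyEq h2).fderiv]
  rfl

/-- Near `β₀` the integrability demanded of a root is automatic. -/
lemma isScoreRoot_iff (h : M.LocalEnvelope β₀ ρ b ε K) {β : M.par}
    (hβ : (β : Param p q) ∈ Metric.ball β₀ ρ) {x : SubParam p k}
    (hx : augment β₀ k x ∈ Metric.ball β₀ ρ) :
    M.IsScoreRoot β₀ β k x ↔
      restrictCLM p k (M.meanScore (β, augment β₀ k x)) = 0 := by
  have h1 := h.integrable_score_law hβ hx
  have h2 : (fun y => M.subScore β₀ k y x) =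
      fun y => restrictCLM p k (M.score y (augment β₀ k x)) :=
    funext fun y => h.subScore_eq y hx
  rw [IsScoreRoot, h2, ContinuousLinearMap.integral_comp_comm _ h1, integral_score_law]
  exact ⟨fun h3 => h3.2.2,
    fun h3 => ⟨h.ball_subset hx, (restrictCLM p k).integrable_comp h1, h3⟩⟩

end

variable {β₀ : M.par} {ρ ε K : ℝ} {b : 𝒴 → ℝ}

/-- The implicit function theorem, applied to the expected score of the candidate model: near
`(β₀, β_{0,k})` the roots form the graph of a function `φ` of the true parameter, and
`Dφ(β₀) = J_k⁻¹ R_k J`, where `R_k` is the restriction to the coordinates of the model. -/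
theorem exists_root_function (h : M.LocalEnvelope β₀ ρ b ε K) (hreg : M.Regular β₀)
    (k : Finset (Fin q)) :
    ∃ φ : Param p q → SubParam p k, φ β₀ = restrict k (β₀ : Param p q) ∧
      HasFDerivAt φ (Matrix.toEuclideanCLM (𝕜 := ℝ) (M.subFisher β₀ k)⁻¹ ∘L restrictCLM p k ∘L
        Matrix.toEuclideanCLM (𝕜 := ℝ) (M.fisher β₀)) (β₀ : Param p q) ∧
      ∀ᶠ x : Param p q × SubParam p k in 𝓝 ((β₀ : Param p q), restrict k (β₀ : Param p q)),
        x.1 ∈ Metric.ball (β₀ : Param p q) ρ ∧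
        augment (β₀ : Param p q) k x.2 ∈ Metric.ball (β₀ : Param p q) ρ ∧
        (restrictCLM p k (M.meanScore (x.1, augment β₀ k x.2)) = 0 ↔ φ x.1 = x.2) := by
  set A := Matrix.toEuclideanCLM (𝕜 := ℝ) (M.fisher β₀) with hA
  set Ak := Matrix.toEuclideanCLM (𝕜 := ℝ) (M.subFisher β₀ k) with hAk
  set Bk := Matrix.toEuclideanCLM (𝕜 := ℝ) (M.subFisher β₀ k)⁻¹ with hBk
  have hAk' : Ak = restrictCLM p k ∘L A ∘L embedCLM p k := toEuclideanCLM_submatrix _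
  have hdet := hreg.isUnit_det_subFisher k
  have hAB : Ak ∘L Bk = .id ℝ _ := by
    change Ak * Bk = 1
    rw [hAk, hBk, ← map_mul, Matrix.mul_nonsing_inv _ hdet, map_one]
  have hBA : Bk ∘L Ak = .id ℝ _ := by
    change Bk * Ak = 1
    rw [hAk, hBk, ← map_mul, Matrix.nonsing_inv_mul _ hdet, map_one]
  let u : Param p q × SubParam p k := ((β₀ : Param p q), restrict k (β₀ : Param p q))
  let F : Param p q × SubParam p k → SubParam p k := fun x =>
    restrictCLM p k (M.meanScore (x.1, augment β₀ k x.2))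
  let F' : Param p q × SubParam p k →L[ℝ] SubParam p k := restrictCLM p k ∘L
    M.meanScoreDeriv (β₀, β₀) ∘L (ContinuousLinearMap.fst ℝ _ _).prod
      (embedCLM p k ∘L ContinuousLinearMap.snd ℝ _ _)
  have hF' : ∀ v w, F' (v, w) = restrictCLM p k (A (v - embedCLM p k w)) := fun v w => by
    simp [F', h.meanScoreDeriv_center, hA]
  have hu : augment (β₀ : Param p q) k u.2 = β₀ := augment_restrict _
  have hF : HasStrictFDerivAt F F' u := by
    have h1 : HasStrictFDerivAt (fun x : Param p q × SubParam p k =>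
        (x.1, augment (β₀ : Param p q) k x.2)) ((ContinuousLinearMap.fst ℝ _ _).prod
          (embedCLM p k ∘L ContinuousLinearMap.snd ℝ _ _)) u :=
      hasStrictFDerivAt_fst.prodMk
        ((hasStrictFDerivAt_augment (β₀ : Param p q) u.2).comp u hasStrictFDerivAt_snd)
    have h2 : HasStrictFDerivAt M.meanScore (M.meanScoreDeriv (β₀, β₀))
        (u.1, augment (β₀ : Param p q) k u.2) := by
      rw [hu]
      exact h.hasStrictFDerivAt_meanScore
    exact (restrictCLM p k).hasStrictFDerivAt.comp u
      (HasStrictFDerivAt.comp (f := fun x : Param p q × SubParam p k =>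
        (x.1, augment (β₀ : Param p q) k x.2)) u h2 h1)
  have hinr : F' ∘L .inr ℝ _ _ = -Ak := by
    refine ContinuousLinearMap.ext fun w => ?_
    simp [hF', hAk']
  have hinl : F' ∘L .inl ℝ _ _ = restrictCLM p k ∘L A := by
    refine ContinuousLinearMap.ext fun w => ?_
    simp [hF']
  have hinv1 : (F' ∘L .inr ℝ _ _) ∘L (-Bk) = .id ℝ _ := by
    rw [hinr, ContinuousLinearMap.neg_comp, ContinuousLinearMap.comp_neg, neg_neg, hAB]
  have hinv2 : (-Bk) ∘L (F' ∘L .inr ℝ _ _) = .id ℝ _ := by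
    rw [hinr, ContinuousLinearMap.neg_comp, ContinuousLinearMap.comp_neg, neg_neg, hBA]
  have hinv : (F' ∘L .inr ℝ _ _).IsInvertible :=
    ContinuousLinearMap.IsInvertible.of_inverse hinv1 hinv2
  have hFu : F u = 0 := by
    have h1 : F u = restrictCLM p k (M.meanScore (u.1, augment β₀ k u.2)) := rfl
    rw [h1, hu, h.meanScore_diag h.center_mem, map_zero]
  refine ⟨hF.implicitFunctionOfProdDomain hinv, ?_, ?_, ?_⟩
  · exact (hF.eventually_apply_eq_iff_implicitFunctionOfProdDomain hinv).self_of_nhds.1 rfl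
  · have h1 := (hF.hasStrictFDerivAt_implicitFunctionOfProdDomain hinv).hasFDerivAt
    rw [ContinuousLinearMap.inverse_eq hinv1 hinv2, hinl, ContinuousLinearMap.neg_comp, neg_neg] at h1
    exact h1
  · have h1 : ∀ᶠ x : Param p q × SubParam p k in 𝓝 u, x.1 ∈ Metric.ball (β₀ : Param p q) ρ :=
      continuous_fst.continuousAt (Metric.isOpen_ball.mem_nhds h.center_mem)
    have h2 : ∀ᶠ x : Param p q × SubParam p k in 𝓝 u,
        augment (β₀ : Param p q) k x.2 ∈ Metric.ball (β₀ : Param p q) ρ :=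
      ((continuous_augment _).comp continuous_snd).continuousAt.eventually
        (Metric.isOpen_ball.mem_nhds (by simpa [hu] using h.radius_pos))
    filter_upwards [h1, h2, hF.eventually_apply_eq_iff_implicitFunctionOfProdDomain hinv]
      with x hx1 hx2 hx3
    rw [hFu] at hx3
    exact ⟨hx1, hx2, hx3⟩

end LocalEnvelope

end ParametricModel

/-! ### Convergence in distribution, deterministic shifts and Gaussian linear forms -/

/-- Adding a convergent sequence of constants shifts the limit distribution. The probability spaces
may vary with `n`, and the limit variables may live on different spaces. -/
lemma tendstoInDistribution_add_const {Ω : ℕ → Type*} [∀ n, MeasurableSpace (Ω n)]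
    {P : (n : ℕ) → Measure (Ω n)} [∀ n, IsProbabilityMeasure (P n)]
    {Ω' Ω'' : Type*} [MeasurableSpace Ω'] [MeasurableSpace Ω'']
    {Q : Measure Ω'} [IsProbabilityMeasure Q] {Q' : Measure Ω''} [IsProbabilityMeasure Q']
    {X X' : (n : ℕ) → Ω n → ℝ} {Z : Ω' → ℝ} {Z' : Ω'' → ℝ} {a : ℕ → ℝ} {a₀ : ℝ}
    (ha : Tendsto a atTop (𝓝 a₀)) (hX' : ∀ n ω, X' n ω = X n ω + a n)
    (hZ' : AEMeasurable Z' Q') (hZ : Q'.map Z' = (Q.map Z).map (· + a₀))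
    (h : TendstoInDistribution X atTop Z P Q) : TendstoInDistribution X' atTop Z' P Q' := by
  have hX'' : ∀ n, X' n = fun ω => X n ω + a n := fun n => funext (hX' n)
  have hm : ∀ n, AEMeasurable (X' n) (P n) := fun n => by
    rw [hX'']
    exact (h.forall_aemeasurable n).add_const _
  refine ⟨hm, hZ', ?_⟩
  have h1 := ProbabilityMeasure.tendsto_iff_tendsto_charFun.1 h.tendsto
  refine ProbabilityMeasure.tendsto_iff_tendsto_charFun.2 fun t => ?_
  have h2 : ∀ n, (P n).map (X' n) = ((P n).map (X n)).map (· + a n) := fun n => by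
    rw [AEMeasurable.map_map_of_aemeasurable (by fun_prop) (h.forall_aemeasurable n), hX'']
    rfl
  simp only [ProbabilityMeasure.coe_mk, h2, hZ, charFun_map_add_const]
  refine (h1 t).mul ?_
  have h3 : Continuous fun r : ℝ => Complex.exp ((inner ℝ r t : ℝ) * Complex.I) := by fun_prop
  exact (h3.tendsto a₀).comp ha

/-- The variance of a linear form depends on the covariance matrix only. -/
lemma variance_inner_eq_sum {ι Ω : Type*} [Fintype ι] [MeasurableSpace Ω] {P : Measure Ω}
    [IsProbabilityMeasure P] {X : Ω → EuclideanSpace ℝ ι} (hX : MemLp X 2 P)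
    (c : EuclideanSpace ℝ ι) :
    Var[fun ω => inner ℝ c (X ω); P] =
      ∑ i, ∑ j, c i * (c j * cov[fun ω => X ω i, fun ω => X ω j; P]) := by
  have h1 : ∀ i, MemLp (fun ω => X ω i) 2 P := fun i =>
    (EuclideanSpace.proj i : EuclideanSpace ℝ ι →L[ℝ] ℝ).comp_memLp' hX
  have h2 : (fun ω => inner ℝ c (X ω)) = fun ω => ∑ i, c i * X ω i := by
    funext ω
    simp [PiLp.inner_apply, mul_comm]
  rw [h2, variance_fun_sum fun i => (h1 i).const_mul (c i)]
  simp_rw [covariance_const_mul_left, covariance_const_mul_right]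

section Gaussian

variable {ι : Type*} [Fintype ι] [DecidableEq ι] {S : Matrix ι ι ℝ}

lemma integral_inner_multivariateGaussian (c : EuclideanSpace ℝ ι) :
    ∫ z, inner ℝ c z ∂(multivariateGaussian 0 S) = 0 := by
  have := (innerSL ℝ c).integral_comp_comm
    (IsGaussian.integrable_fun_id (μ := multivariateGaussian 0 S))
  rw [integral_id_multivariateGaussian] at this
  simpa using this

lemma map_add_inner_multivariateGaussian (a : ℝ) (c : EuclideanSpace ℝ ι) {σ2 : ℝ≥0}
    (hσ : Var[fun z => inner ℝ c z; multivariateGaussian 0 S] = σ2) :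
    (multivariateGaussian 0 S).map (fun z => a + inner ℝ c z) = gaussianReal a σ2 := by
  have h1 := IsGaussian.map_eq_gaussianReal (μ := multivariateGaussian 0 S) (innerSL ℝ c)
  have h2 : (multivariateGaussian 0 S)[innerSL ℝ c] = 0 := integral_inner_multivariateGaussian c
  have h3 : Var[innerSL ℝ c; multivariateGaussian 0 S] = σ2 := hσ
  rw [h2, h3, Real.toNNReal_coe] at h1
  have h4 : (fun z => a + inner ℝ c z) = (a + ·) ∘ (innerSL ℝ c) := rfl
  rw [h4, ← Measure.map_map (by fun_prop) (by fun_prop), h1, gaussianReal_map_const_add, zero_add]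

end Gaussian

/-! ### The influence functions and the limit variable as linear forms in the score -/

namespace ParametricModel

variable {p q : ℕ} {𝒴 : Type*} [MeasurableSpace 𝒴] {M : ParametricModel p q 𝒴}
  {k : Finset (Fin q)}

/-- The vector `c` of the full parameter space with `⟪c, z⟫ = ∇_k μ(β)ᵀ H⁻¹ z_k`. -/
noncomputable def influenceVec (μ : Param p q → ℝ) (k : Finset (Fin q))
    (H : Matrix (Fin p ⊕ k) (Fin p ⊕ k) ℝ) (β : Param p q) : Param p q :=
  embedCLM p k (WithLp.toLp 2 (H⁻¹ᵀ *ᵥ subGrad μ k β))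

lemma inner_influenceVec (μ : Param p q → ℝ) (H : Matrix (Fin p ⊕ k) (Fin p ⊕ k) ℝ)
    (β z : Param p q) :
    inner ℝ (influenceVec μ k H β) z = subGrad μ k β ⬝ᵥ (H⁻¹ *ᵥ fun i => z (incl p k i)) := by
  rw [real_inner_comm, influenceVec, inner_embedCLM, real_inner_comm,
    EuclideanSpace.inner_eq_star_dotProduct, Matrix.dotProduct_mulVec, Matrix.mulVec_transpose,
    dotProduct_comm]
  rfl

lemma influenceVec_neg (μ : Param p q → ℝ) {H : Matrix (Fin p ⊕ k) (Fin p ⊕ k) ℝ}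
    (hH : IsUnit H.det) (β : Param p q) :
    influenceVec μ k (-H) β = -influenceVec μ k H β := by
  have h1 : (-H)⁻¹ = -H⁻¹ := Matrix.inv_eq_right_inv (by simp [Matrix.mul_nonsing_inv _ hH])
  rw [influenceVec, influenceVec, h1, Matrix.transpose_neg, Matrix.neg_mulVec, WithLp.toLp_neg,
    map_neg]

lemma tendsto_influenceVec {μ : Param p q → ℝ} {β₀ : Param p q} (hμ : ContDiffAt ℝ 1 μ β₀)
    (H : Matrix (Fin p ⊕ k) (Fin p ⊕ k) ℝ) {ι : Type*} {l : Filter ι} {β : ι → Param p q}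
    (hβ : Tendsto β l (𝓝 β₀)) :
    Tendsto (fun n => influenceVec μ k H (β n)) l (𝓝 (influenceVec μ k H β₀)) := by
  have h1 : Tendsto (fun n => gradient μ (β n)) l (𝓝 (gradient μ β₀)) :=
    ((InnerProductSpace.toDual ℝ (Param p q)).symm.continuous.tendsto _).comp
      ((hμ.continuousAt_fderiv (by norm_num)).tendsto.comp hβ)
  have h2 : Continuous fun g : Param p q =>
      embedCLM p k (WithLp.toLp 2 (H⁻¹ᵀ *ᵥ fun i => g (incl p k i))) := by
    refine (embedCLM p k).continuous.comp ((PiLp.continuous_toLp 2 _).comp ?_)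
    refine Continuous.matrix_mulVec continuous_const ?_
    fun_prop
  exact (h2.tendsto _).comp h1

namespace LocalEnvelope

lemma influence_eq {β₀ : M.par} {ρ ε K : ℝ} {b : 𝒴 → ℝ} (h : M.LocalEnvelope β₀ ρ b ε K)
    (μ : Param p q → ℝ) (H : Matrix (Fin p ⊕ k) (Fin p ⊕ k) ℝ) {x : SubParam p k}
    (hx : augment (β₀ : Param p q) k x ∈ Metric.ball (β₀ : Param p q) ρ) (y : 𝒴) :
    M.influence β₀ μ k H x y = inner ℝ (influenceVec μ k H (augment β₀ k x))
      (M.score y (augment β₀ k x)) := by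
  rw [inner_influenceVec, influence, h.subScore_eq y hx]
  rfl

end LocalEnvelope

/-- The coefficient vector of the linear form `z ↦ ∑ w_k Λ_k(z) - ∑ w_k Λ_k(0)`. -/
noncomputable def hcVec (M : ParametricModel p q 𝒴) (β₀ : M.par) (μ : Param p q → ℝ)
    (𝓜 : Finset (Finset (Fin q))) (w : Finset (Fin q) → ℝ) : Param p q :=
  ∑ k ∈ 𝓜, w k • influenceVec μ k (M.subFisher β₀ k) β₀

lemma hcLambda_eq (β₀ : M.par) (δ : Fin q → ℝ) (μ : Param p q → ℝ) (z : Param p q) :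
    M.hcLambda β₀ δ μ k z =
      M.hcLambda β₀ δ μ k 0 + inner ℝ (influenceVec μ k (M.subFisher β₀ k) β₀) z := by
  rw [inner_influenceVec, hcLambda, hcLambda]
  have h1 : (fun i => (0 : Param p q) (incl p k i)) = 0 := rfl
  rw [h1, Matrix.mulVec_zero, add_zero, dotProduct_add]
  ring

lemma hcSum_eq (β₀ : M.par) (δ : Fin q → ℝ) (μ : Param p q → ℝ) (𝓜 : Finset (Finset (Fin q)))
    (w : Finset (Fin q) → ℝ) (z : Param p q) :
    M.hcSum β₀ δ μ 𝓜 w z = M.hcSum β₀ δ μ 𝓜 w 0 + inner ℝ (M.hcVec β₀ μ 𝓜 w) z := by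
  simp only [hcSum, hcVec, sum_inner, inner_smul_left, conj_trivial]
  rw [← Finset.sum_add_distrib]
  exact Finset.sum_congr rfl fun k _ => by rw [hcLambda_eq, mul_add]

/-! ### The local alternatives and the bias -/

/-- The direction `(0, δ)` of the local alternatives. -/
noncomputable def localDir {p q : ℕ} (δ : Fin q → ℝ) : Param p q :=
  WithLp.toLp 2 (Sum.elim 0 δ)

lemma localParam_eq (β₀ : Param p q) (δ : Fin q → ℝ) (n : ℕ) :
    localParam β₀ δ n = β₀ + (√(n : ℝ))⁻¹ • localDir δ := by
  ext i
  rcases i with i | j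
  · simp [localParam, localDir]
  · simp [localParam, localDir, div_eq_inv_mul]

lemma tendsto_sqrt_natCast : Tendsto (fun n : ℕ => √(n : ℝ)) atTop atTop :=
  Real.tendsto_sqrt_atTop.comp tendsto_natCast_atTop_atTop

lemma tendsto_localParam (β₀ : Param p q) (δ : Fin q → ℝ) :
    Tendsto (localParam β₀ δ) atTop (𝓝 β₀) := by
  have h1 : Tendsto (fun n : ℕ => β₀ + (√(n : ℝ))⁻¹ • localDir (p := p) δ) atTop
      (𝓝 (β₀ + (0 : ℝ) • localDir δ)) :=
    tendsto_const_nhds.add ((tendsto_inv_atTop_zero.comp tendsto_sqrt_natCast).smul_const _)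
  simpa [← localParam_eq] using h1

lemma proj_mulVec (v : Fin q → ℝ) (j : k) : (proj k *ᵥ v) j = v j := by
  simp [proj, Matrix.mulVec, dotProduct]

/-- The derivative of the pseudo-true parameter in the direction of the local alternatives gives
the mean of `Λ_k`. -/
lemma hcLambda_zero (β₀ : M.par) (δ : Fin q → ℝ) (μ : Param p q → ℝ) :
    M.hcLambda β₀ δ μ k 0 = inner ℝ (gradient μ β₀)
      (embedCLM p k (Matrix.toEuclideanCLM (𝕜 := ℝ) (M.subFisher β₀ k)⁻¹ (restrictCLM p k
        (Matrix.toEuclideanCLM (𝕜 := ℝ) (M.fisher β₀) (localDir δ)))) - localDir δ) := by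
  have h1 : (fun i => (0 : Param p q) (incl p k i)) = 0 := rfl
  rw [hcLambda, h1, Matrix.mulVec_zero, add_zero, inner_sub_right, inner_embedCLM]
  congr 1
  · rw [EuclideanSpace.inner_eq_star_dotProduct, dotProduct_comm]
    have h2 : WithLp.ofLp (restrictCLM p k (Matrix.toEuclideanCLM (𝕜 := ℝ) (M.fisher β₀)
        (localDir δ))) = Sum.elim ((M.fisher β₀).toBlocks₁₂ *ᵥ δ)
          (proj k *ᵥ ((M.fisher β₀).toBlocks₂₂ *ᵥ δ)) := by
      funext i
      rw [restrictCLM_ofLp, Matrix.ofLp_toEuclideanCLM]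
      rcases i with i | j
      · simp [incl, Matrix.mulVec, dotProduct, localDir, Matrix.toBlocks₁₂]
      · rw [Sum.elim_inr, proj_mulVec]
        simp [incl, Matrix.mulVec, dotProduct, localDir, Matrix.toBlocks₂₂]
    rw [Matrix.ofLp_toEuclideanCLM, h2]
    rfl
  · rw [PiLp.inner_apply, Fintype.sum_sum_type]
    simp [dotProduct, localDir, mul_comm]

/-- The bias `μ(β*_k) - μ(β_true)` is a differentiable function of `β_true`. -/
lemma tendsto_bias {β₀ : M.par} {μ : Param p q → ℝ} (hμ : DifferentiableAt ℝ μ β₀)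
    {φ : Param p q → SubParam p k} (hφ0 : φ β₀ = restrict k (β₀ : Param p q))
    (hφ : HasFDerivAt φ (Matrix.toEuclideanCLM (𝕜 := ℝ) (M.subFisher β₀ k)⁻¹ ∘L restrictCLM p k ∘L
      Matrix.toEuclideanCLM (𝕜 := ℝ) (M.fisher β₀)) (β₀ : Param p q)) (δ : Fin q → ℝ) :
    Tendsto (fun n : ℕ => √(n : ℝ) * (μ (augment β₀ k (φ (localParam β₀ δ n))) -
      μ (localParam β₀ δ n))) atTop (𝓝 (M.hcLambda β₀ δ μ k 0)) := by
  have haug : augment (β₀ : Param p q) k (φ β₀) = β₀ := by rw [hφ0, augment_restrict]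
  have h1 : HasFDerivAt μ (innerSL ℝ (gradient μ β₀)) (β₀ : Param p q) :=
    hasGradientAt_iff_hasFDerivAt.1 hμ.hasGradientAt
  have h2 := (hasStrictFDerivAt_augment (β₀ : Param p q) (φ β₀)).hasFDerivAt.comp
    (β₀ : Param p q) hφ
  have h3 : HasFDerivAt μ (innerSL ℝ (gradient μ β₀))
      ((augment (β₀ : Param p q) k ∘ φ) (β₀ : Param p q)) := by
    rw [Function.comp_apply, haug]
    exact h1
  have h4 := (h3.comp (β₀ : Param p q) h2).sub h1
  have hc : Tendsto (fun n : ℕ => ‖√(n : ℝ)‖) atTop atTop :=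
    tendsto_norm_atTop_atTop.comp tendsto_sqrt_natCast
  have h5 := h4.lim (localDir δ) hc
  rw [hcLambda_zero, inner_sub_right]
  simpa [← localParam_eq, haug] using h5

end ParametricModel

namespace ParametricModel

variable {p q : ℕ} {𝒴 : Type*} [MeasurableSpace 𝒴] {M : ParametricModel p q 𝒴}
  {k : Finset (Fin q)}

/-! ### Integrals with respect to the law of the sample -/

lemma mean_integral_sampleLaw {n : ℕ} (hn : n ≠ 0) (β : M.par) {F : 𝒴 → ℝ}
    (hF : AEStronglyMeasurable F (M.law β)) :
    (1 / (n : ℝ)) * ∑ i : Fin n, ∫ Y, F (Y i) ∂(M.sampleLaw n β) = ∫ y, F y ∂(M.law β) := by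
  have h1 : ∀ i : Fin n, ∫ Y, F (Y i) ∂(M.sampleLaw n β) = ∫ y, F y ∂(M.law β) := fun i =>
    integral_comp_eval (μ := fun _ : Fin n => M.law β) hF
  have hn' : (n : ℝ) ≠ 0 := Nat.cast_ne_zero.2 hn
  simp [h1, hn']

lemma measurePreserving_eval_sampleLaw {n : ℕ} (β : M.par) (i : Fin n) :
    MeasurePreserving (fun Y : Fin n → 𝒴 => Y i) (M.sampleLaw n β) (M.law β) :=
  measurePreserving_eval (fun _ : Fin n => M.law β) i

lemma meanHessian_eq (β₀ : Param p q) {n : ℕ} (hn : n ≠ 0) (β : M.par) {x : SubParam p k}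
    {i j : Fin p ⊕ k} (hi : Integrable (fun y => M.subHessian β₀ k y x i j) (M.law β)) :
    M.meanHessian β₀ n β k x i j = ∫ y, M.subHessian β₀ k y x i j ∂(M.law β) := by
  rw [meanHessian, Matrix.of_apply, integral_finsetSum, mean_integral_sampleLaw hn β hi.1]
  exact fun l _ => (measurePreserving_eval_sampleLaw β l).integrable_comp_of_integrable hi

namespace LocalEnvelope

variable {β₀ : M.par} {ρ ε K : ℝ} {b : 𝒴 → ℝ}

lemma tendsto_integral_law (h : M.LocalEnvelope β₀ ρ b ε K) {β : ℕ → M.par}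
    (hβ : Tendsto (fun n => (β n : Param p q)) atTop (𝓝 β₀)) {g : ℕ → 𝒴 → ℝ} {g₀ : 𝒴 → ℝ} {c : ℝ}
    (hc : 0 ≤ c) (hg : ∀ᶠ n in atTop, Measurable (g n))
    (hgb : ∀ᶠ n in atTop, ∀ y, |g n y| ≤ c * b y)
    (hg₀ : Measurable g₀) (hg₀b : ∀ y, |g₀ y| ≤ c * b y)
    (hlim : ∀ y, Tendsto (fun n => g n y) atTop (𝓝 (g₀ y))) :
    Tendsto (fun n => ∫ y, g n y ∂(M.law (β n))) atTop (𝓝 (∫ y, g₀ y ∂(M.law β₀))) := by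
  have hmem : ∀ᶠ n in atTop, (β n : Param p q) ∈ Metric.ball (β₀ : Param p q) ρ :=
    hβ.eventually (Metric.isOpen_ball.mem_nhds h.center_mem)
  simp only [integral_law]
  refine h.tendsto_integral hmem hc ?_ ?_ ?_ ?_ fun y => ?_
  · filter_upwards [hmem, hg] with n hn hgn
    exact (h.aestronglyMeasurable_f hn).smul hgn.aestronglyMeasurable
  · filter_upwards [hmem, hgb] with n hn hgn y
    exact h.norm_f_smul_le hn y (hgn y)
  · exact (h.aestronglyMeasurable_f h.center_mem).smul hg₀.aestronglyMeasurable
  · exact fun y => h.norm_f_smul_le h.center_mem y (hg₀b y)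
  · exact ((h.continuousAt_f y h.center_mem).tendsto.comp hβ).smul (hlim y)

/-! ### Moments and limits of score and Hessian in a candidate model -/

lemma tendsto_augment {x : ℕ → SubParam p k}
    (hx : Tendsto x atTop (𝓝 (restrict k (β₀ : Param p q)))) :
    Tendsto (fun n => augment (β₀ : Param p q) k (x n)) atTop (𝓝 (β₀ : Param p q)) := by
  have := ((continuous_augment (β₀ : Param p q) (k := k)).tendsto _).comp hx
  rwa [augment_restrict] at this

lemma memLp_subScore (h : M.LocalEnvelope β₀ ρ b ε K) {β : M.par}
    (hβ : (β : Param p q) ∈ Metric.ball (β₀ : Param p q) ρ) {x : SubParam p k}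
    (hx : augment (β₀ : Param p q) k x ∈ Metric.ball (β₀ : Param p q) ρ) :
    MemLp (fun y => M.subScore β₀ k y x) 2 (M.law β) := by
  have h1 : (fun y => M.subScore β₀ k y x) =
      fun y => restrictCLM p k (M.score y (augment β₀ k x)) :=
    funext fun y => h.subScore_eq y hx
  rw [h1]
  exact (restrictCLM p k).comp_memLp' (h.memLp_score_law hβ hx)

lemma integrable_subHessian (h : M.LocalEnvelope β₀ ρ b ε K) {β : M.par}
    (hβ : (β : Param p q) ∈ Metric.ball (β₀ : Param p q) ρ) {x : SubParam p k}
    (hx : augment (β₀ : Param p q) k x ∈ Metric.ball (β₀ : Param p q) ρ) (i j : Fin p ⊕ k) :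
    Integrable (fun y => M.subHessian β₀ k y x i j) (M.law β) := by
  rw [integrable_law_iff]
  have h1 := (EuclideanSpace.proj (incl p k i) : Param p q →L[ℝ] ℝ).integrable_comp
    ((h.integrable_weightedScoreDeriv hβ hx).apply_continuousLinearMap
      (0, embedCLM p k (EuclideanSpace.single j 1)))
  refine h1.congr (ae_of_all _ fun y => ?_)
  simp [h.subHessian_eq y hx]

lemma integral_subHessian (h : M.LocalEnvelope β₀ ρ b ε K) {β : M.par}
    (hβ : (β : Param p q) ∈ Metric.ball (β₀ : Param p q) ρ) {x : SubParam p k}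
    (hx : augment (β₀ : Param p q) k x ∈ Metric.ball (β₀ : Param p q) ρ) (i j : Fin p ⊕ k) :
    ∫ y, M.subHessian β₀ k y x i j ∂(M.law β) = M.meanScoreDeriv (β, augment β₀ k x)
      (0, embedCLM p k (EuclideanSpace.single j 1)) (incl p k i) := by
  have hint := h.integrable_weightedScoreDeriv hβ hx
  have h2 := (EuclideanSpace.proj (incl p k i) : Param p q →L[ℝ] ℝ).integral_comp_comm
    (hint.apply_continuousLinearMap (0, embedCLM p k (EuclideanSpace.single j 1)))
  rw [← ContinuousLinearMap.integral_apply hint] at h2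
  rw [integral_law, meanScoreDeriv]
  refine Eq.trans ?_ h2
  congr 1
  funext y
  simp [h.subHessian_eq y hx]

lemma tendsto_meanHessian (h : M.LocalEnvelope β₀ ρ b ε K) {β : ℕ → M.par}
    (hβ : Tendsto (fun n => (β n : Param p q)) atTop (𝓝 β₀)) {x : ℕ → SubParam p k}
    (hx : Tendsto x atTop (𝓝 (restrict k (β₀ : Param p q)))) :
    Tendsto (fun n => M.meanHessian β₀ n (β n) k (x n)) atTop (𝓝 (-M.subFisher β₀ k)) := by
  have hball := Metric.isOpen_ball.mem_nhds h.center_mem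
  refine tendsto_pi_nhds.2 fun i => tendsto_pi_nhds.2 fun j => ?_
  have h1 : Tendsto (fun n => M.meanScoreDeriv (β n, augment (β₀ : Param p q) k (x n)))
      atTop (𝓝 (M.meanScoreDeriv (β₀, β₀))) :=
    h.continuousAt_meanScoreDeriv.tendsto.comp (hβ.prodMk_nhds (tendsto_augment hx))
  have h2 : Continuous fun L : Param p q × Param p q →L[ℝ] Param p q =>
      L (0, embedCLM p k (EuclideanSpace.single j 1)) (incl p k i) := by fun_prop
  have h3 := (h2.tendsto _).comp h1
  rw [h.meanScoreDeriv_center, zero_sub, map_neg] at h3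
  have h4 : (-M.subFisher β₀ k) i j = (-Matrix.toEuclideanCLM (𝕜 := ℝ) (M.fisher β₀)
      (embedCLM p k (EuclideanSpace.single j 1))) (incl p k i) := by
    have := congrArg (fun L : SubParam p k →L[ℝ] SubParam p k => L (EuclideanSpace.single j 1) i)
      (toEuclideanCLM_submatrix (k := k) (M.fisher β₀))
    simp only [ContinuousLinearMap.comp_apply, restrictCLM_ofLp, Matrix.ofLp_toEuclideanCLM] at this
    simp only [PiLp.neg_apply, Matrix.ofLp_toEuclideanCLM, Matrix.neg_apply, ← this, subFisher]
    simp
  rw [h4]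
  refine h3.congr' ?_
  filter_upwards [hβ.eventually hball, (tendsto_augment hx).eventually hball, eventually_ne_atTop 0]
    with n hn1 hn2 hn3
  rw [meanHessian_eq _ hn3 _ (h.integrable_subHessian hn1 hn2 i j), h.integral_subHessian hn1 hn2]
  rfl

/-! ### The Lindeberg condition and the asymptotic variance -/

lemma norm_score_le_sqrt {β₀ β : Param p q} (h : M.LocalEnvelope β₀ ρ b ε K) (y : 𝒴)
    (hβ : β ∈ Metric.ball β₀ ρ) : ‖M.score y β‖ ≤ √(b y) :=
  Real.le_sqrt_of_sq_le (h.norm_score_sq_le y β hβ)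

variable {𝓜 : Finset (Finset (Fin q))} {x : ℕ → (k : Finset (Fin q)) → SubParam p k}
  {μ : Param p q → ℝ} {w : Finset (Fin q) → ℝ} {β : ℕ → M.par}

lemma tendsto_influence (h : M.LocalEnvelope β₀ ρ b ε K) (hμ : ContDiffAt ℝ 1 μ β₀)
    {x : ℕ → SubParam p k} (hx : Tendsto x atTop (𝓝 (restrict k (β₀ : Param p q))))
    (H : Matrix (Fin p ⊕ k) (Fin p ⊕ k) ℝ) (y : 𝒴) :
    Tendsto (fun n => M.influence β₀ μ k H (x n) y) atTop
      (𝓝 (inner ℝ (influenceVec μ k H β₀) (M.score y β₀))) := by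
  have h1 := (tendsto_influenceVec hμ H (tendsto_augment hx)).inner (𝕜 := ℝ)
    ((h.continuousAt_score y h.center_mem).tendsto.comp (tendsto_augment hx))
  refine h1.congr' ?_
  filter_upwards [(tendsto_augment hx).eventually (Metric.isOpen_ball.mem_nhds h.center_mem)]
    with n hn
  rw [h.influence_eq μ H hn]
  rfl

lemma measurable_influence (h : M.LocalEnvelope β₀ ρ b ε K)
    (H : Matrix (Fin p ⊕ k) (Fin p ⊕ k) ℝ) {x : SubParam p k}
    (hx : augment (β₀ : Param p q) k x ∈ Metric.ball (β₀ : Param p q) ρ) :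
    Measurable (M.influence β₀ μ k H x) := by
  have h1 : M.influence β₀ μ k H x = fun y =>
      inner ℝ (influenceVec μ k H (augment β₀ k x)) (M.score y (augment β₀ k x)) :=
    funext fun y => h.influence_eq μ H hx y
  rw [h1]
  exact (h.measurable_score hx).const_inner

lemma exists_eventually_influence_le (h : M.LocalEnvelope β₀ ρ b ε K) (hμ : ContDiffAt ℝ 1 μ β₀)
    (hx : ∀ k ∈ 𝓜, Tendsto (fun n => x n k) atTop (𝓝 (restrict k (β₀ : Param p q))))
    (H : (k : Finset (Fin q)) → Matrix (Fin p ⊕ k) (Fin p ⊕ k) ℝ) :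
    ∃ C : ℝ, 0 ≤ C ∧ ∀ᶠ n in atTop, ∀ k ∈ 𝓜, ∀ y,
      |M.influence β₀ μ k (H k) (x n k) y| ≤ C * √(b y) := by
  refine ⟨∑ k ∈ 𝓜, (‖influenceVec μ k (H k) β₀‖ + 1), Finset.sum_nonneg fun k _ => by positivity,
    (eventually_all_finset 𝓜).2 fun k hk => ?_⟩
  have h1 := (tendsto_influenceVec hμ (H k) (tendsto_augment (hx k hk))).norm
  filter_upwards [h1.eventually (gt_mem_nhds (lt_add_one _)),
    (tendsto_augment (hx k hk)).eventually (Metric.isOpen_ball.mem_nhds h.center_mem)]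
    with n hn1 hn2 y
  rw [h.influence_eq μ (H k) hn2]
  refine (abs_real_inner_le_norm _ _).trans (mul_le_mul (hn1.le.trans ?_)
    (h.norm_score_le_sqrt y hn2) (norm_nonneg _) (Finset.sum_nonneg fun k _ => by positivity))
  exact Finset.single_le_sum (f := fun k => ‖influenceVec μ k (H k) (β₀ : Param p q)‖ + 1)
    (fun k _ => by positivity) hk

/-- The Lindeberg condition: the summands are dominated by a multiple of the envelope, which is
uniformly integrable under the moving law. -/
theorem tendsto_lindeberg (h : M.LocalEnvelope β₀ ρ b ε K) (hμ : ContDiffAt ℝ 1 μ β₀)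
    (hβ : Tendsto (fun n => (β n : Param p q)) atTop (𝓝 β₀))
    (hx : ∀ k ∈ 𝓜, Tendsto (fun n => x n k) atTop (𝓝 (restrict k (β₀ : Param p q))))
    (H : (k : Finset (Fin q)) → Matrix (Fin p ⊕ k) (Fin p ⊕ k) ℝ) {η : ℝ} (hη : 0 < η) :
    Tendsto (fun n : ℕ => (1 / (n : ℝ)) * ∑ i : Fin n, ∫ Y,
      (let D : ℝ := ((𝓜.sup fun k => ‖M.influence β₀ μ k (H k) (x n k) (Y i)‖₊ : ℝ≥0) : ℝ)
       Set.indicator {d : ℝ | √(n : ℝ) * η < d} (fun d => d ^ 2) D)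
      ∂(M.sampleLaw n (β n))) atTop (𝓝 0) := by
  obtain ⟨C, hC, hbound⟩ := h.exists_eventually_influence_le hμ hx H
  have hball := Metric.isOpen_ball.mem_nhds h.center_mem
  let u : ℕ → 𝒴 → ℝ := fun n =>
    Set.indicator {y | (n : ℝ) * η ^ 2 < C ^ 2 * b y} fun y => C ^ 2 * b y
  have hum : ∀ n, Measurable (u n) := fun n =>
    (h.measurable.const_mul _).indicator
      (measurableSet_lt measurable_const (h.measurable.const_mul _))
  have hu0 : ∀ n y, 0 ≤ u n y := fun n y =>
    Set.indicator_nonneg (fun y _ => mul_nonneg (sq_nonneg C) (h.nonneg y)) y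
  have hub : ∀ n y, |u n y| ≤ C ^ 2 * b y := fun n y => by
    rw [abs_of_nonneg (hu0 n y)]
    exact Set.indicator_le_self' (fun _ _ => mul_nonneg (sq_nonneg C) (h.nonneg y)) y
  have hlim : Tendsto (fun n => ∫ y, u n y ∂(M.law (β n))) atTop (𝓝 0) := by
    have h1 := h.tendsto_integral_law hβ (g := u) (g₀ := fun _ => 0) (sq_nonneg C)
      (.of_forall hum) (.of_forall hub) measurable_const
      (fun y => by simpa using mul_nonneg (sq_nonneg C) (h.nonneg y)) fun y => by
        refine tendsto_const_nhds.congr' ?_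
        have h2 : Tendsto (fun n : ℕ => (n : ℝ) * η ^ 2) atTop atTop :=
          tendsto_natCast_atTop_atTop.atTop_mul_const (by positivity)
        filter_upwards [h2.eventually_ge_atTop (C ^ 2 * b y)] with n hn
        exact (Set.indicator_of_notMem (by simpa using hn) _).symm
    simpa using h1
  refine squeeze_zero' (.of_forall fun n => ?_) ?_ hlim
  · refine mul_nonneg (by positivity) (Finset.sum_nonneg fun i _ => integral_nonneg fun Y => ?_)
    exact Set.indicator_nonneg (fun d _ => sq_nonneg d) _
  · filter_upwards [hbound, hβ.eventually hball, eventually_ne_atTop 0] with n hn hn2 hn3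
    have hui : Integrable (u n) (M.law (β n)) :=
      ((h.integrable_envelope_law hn2).const_mul (C ^ 2)).mono' (hum n).aestronglyMeasurable
        (ae_of_all _ (hub n))
    rw [← mean_integral_sampleLaw hn3 (β n) hui.1]
    refine mul_le_mul_of_nonneg_left (Finset.sum_le_sum fun i _ => ?_) (by positivity)
    refine integral_mono_of_nonneg (ae_of_all _ fun Y =>
        Set.indicator_nonneg (fun d _ => sq_nonneg d) _)
      ((measurePreserving_eval_sampleLaw (β n) i).integrable_comp_of_integrable hui)
      (ae_of_all _ fun Y => ?_)
    set D : ℝ≥0 := 𝓜.sup fun k => ‖M.influence β₀ μ k (H k) (x n k) (Y i)‖₊ with hD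
    have hD1 : (D : ℝ) ≤ C * √(b (Y i)) := by
      have h3 : D ≤ Real.toNNReal (C * √(b (Y i))) := Finset.sup_le fun k hk => by
        rw [← norm_toNNReal]
        exact Real.toNNReal_le_toNNReal (hn k hk (Y i))
      calc (D : ℝ) ≤ Real.toNNReal (C * √(b (Y i))) := NNReal.coe_le_coe.2 h3
        _ = _ := Real.coe_toNNReal _ (by positivity)
    have hD2 : (D : ℝ) ^ 2 ≤ C ^ 2 * b (Y i) := by
      have := pow_le_pow_left₀ D.2 hD1 2
      rwa [mul_pow, Real.sq_sqrt (h.nonneg _)] at this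
    change Set.indicator {d : ℝ | √(n : ℝ) * η < d} (fun d => d ^ 2) (D : ℝ) ≤ u n (Y i)
    by_cases hmem : √(n : ℝ) * η < D
    · rw [Set.indicator_of_mem (by exact hmem)]
      have h4 := pow_lt_pow_left₀ hmem (by positivity) two_ne_zero
      rw [mul_pow, Real.sq_sqrt (Nat.cast_nonneg n)] at h4
      have h5 : u n (Y i) = C ^ 2 * b (Y i) :=
        Set.indicator_of_mem (s := {y | (n : ℝ) * η ^ 2 < C ^ 2 * b y}) (h4.trans_le hD2) _
      rw [h5]
      exact hD2
    · rw [Set.indicator_of_notMem (by exact hmem)]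
      exact hu0 n _

lemma variance_inner_score (h : M.LocalEnvelope β₀ ρ b ε K) (c : Param p q) :
    Var[fun y => inner ℝ c (M.score y β₀); M.law β₀] =
      ∫ y, inner ℝ c (M.score y β₀) ^ 2 ∂(M.law β₀) := by
  have h1 := (innerSL ℝ c).integral_comp_comm (h.integrable_score_law h.center_mem h.center_mem)
  rw [integral_score_law, h.meanScore_diag h.center_mem, map_zero] at h1
  simp only [innerSL_apply_apply] at h1
  rw [variance_of_integral_eq_zero _ h1]
  exact (((h.measurable_score h.center_mem).const_inner).aemeasurable)

lemma variance_inner_multivariateGaussian (h : M.LocalEnvelope β₀ ρ b ε K) (hreg : M.Regular β₀)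
    (c : Param p q) : Var[fun z => inner ℝ c z; multivariateGaussian 0 (M.fisher β₀)] =
      ∫ y, inner ℝ c (M.score y β₀) ^ 2 ∂(M.law β₀) := by
  rw [← h.variance_inner_score, variance_inner_eq_sum (h.memLp_score_law h.center_mem h.center_mem),
    variance_inner_eq_sum (X := fun z => z) IsGaussian.memLp_two_id]
  simp_rw [covariance_eval_multivariateGaussian hreg.posDef.posSemidef]
  rfl

/-- The asymptotic variance: in the limit, `-H_k = J_k` and the influence functions become linear
forms in the score at `β₀`. -/
theorem tendsto_variance_influence (h : M.LocalEnvelope β₀ ρ b ε K) (hreg : M.Regular β₀)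
    (hμ : ContDiffAt ℝ 1 μ β₀) (hβ : Tendsto (fun n => (β n : Param p q)) atTop (𝓝 β₀))
    (hx : ∀ k ∈ 𝓜, Tendsto (fun n => x n k) atTop (𝓝 (restrict k (β₀ : Param p q))))
    (hw : ∀ k ∈ 𝓜, 0 ≤ w k) :
    Tendsto (fun n : ℕ => (1 / (n : ℝ)) * ∑ i : Fin n, ∫ Y,
      (∑ k ∈ 𝓜, w k * M.influence β₀ μ k (-M.subFisher β₀ k) (x n k) (Y i)) ^ 2
      ∂(M.sampleLaw n (β n))) atTop
      (𝓝 (∫ y, inner ℝ (M.hcVec β₀ μ 𝓜 w) (M.score y β₀) ^ 2 ∂(M.law β₀))) := by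
  have hball := Metric.isOpen_ball.mem_nhds h.center_mem
  obtain ⟨C, hC, hbound⟩ := h.exists_eventually_influence_le hμ hx fun k => -M.subFisher β₀ k
  let g : ℕ → 𝒴 → ℝ := fun n y =>
    (∑ k ∈ 𝓜, w k * M.influence β₀ μ k (-M.subFisher β₀ k) (x n k) y) ^ 2
  have hmem : ∀ᶠ n in atTop, ∀ k ∈ 𝓜,
      augment (β₀ : Param p q) k (x n k) ∈ Metric.ball (β₀ : Param p q) ρ :=
    (eventually_all_finset 𝓜).2 fun k hk => (tendsto_augment (hx k hk)).eventually hball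
  have hgm : ∀ᶠ n in atTop, Measurable (g n) := by
    filter_upwards [hmem] with n hn
    exact (Finset.measurable_sum _ fun k hk =>
      (h.measurable_influence _ (hn k hk)).const_mul _).pow_const 2
  have hgb : ∀ᶠ n in atTop, ∀ y, |g n y| ≤ ((∑ k ∈ 𝓜, w k) * C) ^ 2 * b y := by
    filter_upwards [hbound] with n hn y
    have h1 : |∑ k ∈ 𝓜, w k * M.influence β₀ μ k (-M.subFisher β₀ k) (x n k) y| ≤
        (∑ k ∈ 𝓜, w k) * C * √(b y) := by
      refine (Finset.abs_sum_le_sum_abs _ _).trans ?_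
      rw [mul_assoc, Finset.sum_mul]
      refine Finset.sum_le_sum fun k hk => ?_
      rw [abs_mul, abs_of_nonneg (hw k hk)]
      exact mul_le_mul_of_nonneg_left (hn k hk y) (hw k hk)
    have h2 := pow_le_pow_left₀ (abs_nonneg _) h1 2
    rw [mul_pow, Real.sq_sqrt (h.nonneg y), ← abs_pow] at h2
    exact h2
  have hlim : ∀ y, Tendsto (fun n => g n y) atTop
      (𝓝 (inner ℝ (M.hcVec β₀ μ 𝓜 w) (M.score y β₀) ^ 2)) := fun y => by
    have h1 : inner ℝ (M.hcVec β₀ μ 𝓜 w) (M.score y β₀) = -∑ k ∈ 𝓜, w k *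
        inner ℝ (influenceVec μ k (-M.subFisher β₀ k) (β₀ : Param p q)) (M.score y β₀) := by
      simp [hcVec, sum_inner, inner_smul_left, influenceVec_neg _ (hreg.isUnit_det_subFisher _)]
    rw [h1, neg_sq]
    exact (tendsto_finsetSum _ fun k hk =>
      (h.tendsto_influence hμ (hx k hk) _ y).const_mul (w k)).pow 2
  have hg₀b : ∀ y, |inner ℝ (M.hcVec β₀ μ 𝓜 w) (M.score y β₀) ^ 2| ≤
      ((∑ k ∈ 𝓜, w k) * C) ^ 2 * b y := fun y =>
    le_of_tendsto (hlim y).abs (hgb.mono fun n hn => hn y)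
  refine (h.tendsto_integral_law hβ (sq_nonneg _) hgm hgb
    (((h.measurable_score h.center_mem).const_inner).pow_const 2) hg₀b hlim).congr' ?_
  filter_upwards [hgm, eventually_ne_atTop 0] with n hn hn2
  exact (mean_integral_sampleLaw hn2 (β n) hn.aestronglyMeasurable).symm

/-! ### The centred and scaled score of the sample -/

lemma inner_scaledScore (h : M.LocalEnvelope β₀ ρ b ε K) {β : M.par}
    (hβ : (β : Param p q) ∈ Metric.ball (β₀ : Param p q) ρ) (c : Param p q) (n : ℕ)
    (Y : Fin n → 𝒴) :
    inner ℝ c (M.scaledScore β₀ n β Y) = √(n : ℝ) * ((1 / (n : ℝ)) *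
      ∑ i, inner ℝ c (M.score (Y i) β₀) - ∫ y, inner ℝ c (M.score y β₀) ∂(M.law β)) := by
  have h1 := (innerSL ℝ c).integral_comp_comm (h.integrable_score_law hβ h.center_mem)
  simp only [innerSL_apply_apply] at h1
  rw [h1, scaledScore, inner_smul_right, inner_sub_right, inner_smul_right, inner_sum]

lemma memLp_inner_score (h : M.LocalEnvelope β₀ ρ b ε K) {β : M.par}
    (hβ : (β : Param p q) ∈ Metric.ball (β₀ : Param p q) ρ) (c : Param p q) :
    MemLp (fun y => inner ℝ c (M.score y β₀)) 2 (M.law β) :=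
  (innerSL ℝ c).comp_memLp' (h.memLp_score_law hβ h.center_mem)

lemma memLp_inner_scaledScore (h : M.LocalEnvelope β₀ ρ b ε K) {β : M.par}
    (hβ : (β : Param p q) ∈ Metric.ball (β₀ : Param p q) ρ) (c : Param p q) (n : ℕ) :
    MemLp (fun Y => inner ℝ c (M.scaledScore β₀ n β Y)) 2 (M.sampleLaw n β) := by
  simp_rw [h.inner_scaledScore hβ]
  have h1 : ∀ i : Fin n, MemLp (fun Y : Fin n → 𝒴 => inner ℝ c (M.score (Y i) β₀)) 2
      (M.sampleLaw n β) := fun i =>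
    (h.memLp_inner_score hβ c).comp_measurePreserving (measurePreserving_eval_sampleLaw β i)
  have h2 := memLp_finsetSum Finset.univ fun i _ => h1 i
  exact ((h2.const_mul (1 / (n : ℝ))).sub (memLp_const _)).const_mul _

lemma integral_inner_scaledScore (h : M.LocalEnvelope β₀ ρ b ε K) {β : M.par}
    (hβ : (β : Param p q) ∈ Metric.ball (β₀ : Param p q) ρ) (c : Param p q) {n : ℕ} (hn : n ≠ 0) :
    ∫ Y, inner ℝ c (M.scaledScore β₀ n β Y) ∂(M.sampleLaw n β) = 0 := by
  have h1 : ∀ i : Fin n, Integrable (fun Y : Fin n → 𝒴 => inner ℝ c (M.score (Y i) β₀))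
      (M.sampleLaw n β) := fun i =>
    (measurePreserving_eval_sampleLaw β i).integrable_comp_of_integrable
      ((h.memLp_inner_score hβ c).integrable one_le_two)
  simp_rw [h.inner_scaledScore hβ]
  rw [integral_const_mul, integral_sub ((integrable_finsetSum _ fun i _ => h1 i).const_mul _)
    (integrable_const _), integral_const_mul, integral_finsetSum _ fun i _ => h1 i,
    mean_integral_sampleLaw hn β (h.memLp_inner_score hβ c).1]
  simp

lemma variance_inner_scaledScore (h : M.LocalEnvelope β₀ ρ b ε K) {β : M.par}
    (hβ : (β : Param p q) ∈ Metric.ball (β₀ : Param p q) ρ) (c : Param p q) {n : ℕ} (hn : n ≠ 0) :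
    Var[fun Y => inner ℝ c (M.scaledScore β₀ n β Y); M.sampleLaw n β] =
      Var[fun y => inner ℝ c (M.score y β₀); M.law β] := by
  have h1 := variance_sum_pi (μ := fun _ : Fin n => M.law β)
    (X := fun _ y => inner ℝ c (M.score y β₀)) fun _ => h.memLp_inner_score hβ c
  have h2 : (∑ i : Fin n, fun Y : Fin n → 𝒴 => inner ℝ c (M.score (Y i) β₀)) =
      fun Y => ∑ i : Fin n, inner ℝ c (M.score (Y i) β₀) := by
    funext Y
    simp
  rw [h2] at h1
  have h3 : AEStronglyMeasurable (fun Y : Fin n → 𝒴 => 1 / (n : ℝ) *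
      ∑ i : Fin n, inner ℝ c (M.score (Y i) β₀)) (M.sampleLaw n β) := by
    refine ((Finset.univ.measurable_fun_sum fun i _ => ?_).const_mul _).aestronglyMeasurable
    exact ((h.measurable_score h.center_mem).const_inner).comp (measurable_pi_apply i)
  simp_rw [h.inner_scaledScore hβ]
  rw [variance_const_mul, variance_sub_const h3, variance_const_mul]
  change _ * (_ * Var[_; Measure.pi fun _ : Fin n => M.law β]) = _
  rw [h1]
  have hn' : (n : ℝ) ≠ 0 := Nat.cast_ne_zero.2 hn
  simp only [Finset.sum_const, Finset.card_univ, Fintype.card_fin, nsmul_eq_mul]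
  rw [Real.sq_sqrt (Nat.cast_nonneg n)]
  field_simp

lemma tendsto_variance_score (h : M.LocalEnvelope β₀ ρ b ε K)
    (hβ : Tendsto (fun n => (β n : Param p q)) atTop (𝓝 β₀)) (c : Param p q) :
    Tendsto (fun n => Var[fun y => inner ℝ c (M.score y β₀); M.law (β n)]) atTop
      (𝓝 (∫ y, inner ℝ c (M.score y β₀) ^ 2 ∂(M.law β₀))) := by
  have hm : Measurable fun y => inner ℝ c (M.score y β₀) :=
    (h.measurable_score h.center_mem).const_inner
  have hb1 : ∀ y, |inner ℝ c (M.score y β₀)| ≤ ‖c‖ * b y := fun y =>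
    (abs_real_inner_le_norm _ _).trans
      (mul_le_mul_of_nonneg_left (h.norm_score_le y h.center_mem) (norm_nonneg _))
  have hb2 : ∀ y, |inner ℝ c (M.score y β₀) ^ 2| ≤ ‖c‖ ^ 2 * b y := fun y => by
    rw [abs_pow]
    refine (pow_le_pow_left₀ (abs_nonneg _) (abs_real_inner_le_norm _ _) 2).trans ?_
    rw [mul_pow]
    exact mul_le_mul_of_nonneg_left (h.norm_score_sq_le y _ h.center_mem) (sq_nonneg _)
  have h1 := h.tendsto_integral_law hβ (norm_nonneg c) (.of_forall fun _ => hm)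
    (.of_forall fun _ => hb1) hm hb1 fun y => tendsto_const_nhds
  have h2 := h.tendsto_integral_law hβ (sq_nonneg ‖c‖) (.of_forall fun _ => hm.pow_const 2)
    (.of_forall fun _ => hb2) (hm.pow_const 2) hb2 fun y => tendsto_const_nhds
  have h3 : ∫ y, inner ℝ c (M.score y β₀) ∂(M.law β₀) = 0 := by
    have h4 := (innerSL ℝ c).integral_comp_comm (h.integrable_score_law h.center_mem h.center_mem)
    rw [integral_score_law, h.meanScore_diag h.center_mem, map_zero] at h4
    exact h4
  have h5 := h2.sub (h1.pow 2)
  rw [h3] at h5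
  have h6 : ∀ᶠ n in atTop, (β n : Param p q) ∈ Metric.ball (β₀ : Param p q) ρ :=
    hβ.eventually (Metric.isOpen_ball.mem_nhds h.center_mem)
  refine (h5.congr' ?_).trans (by simp)
  filter_upwards [h6] with n hn
  rw [variance_eq_sub (h.memLp_inner_score hn c)]
  rfl

end LocalEnvelope

end ParametricModel

/-! ### Assembly of the limit theorems -/

lemma integral_const_add_of_integral_eq_zero {Ω : Type*} [MeasurableSpace Ω] {P : Measure Ω}
    [IsProbabilityMeasure P] {a : ℝ} {X : Ω → ℝ} (hX : Integrable X P) (h0 : ∫ ω, X ω ∂P = 0) :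
    ∫ ω, (a + X ω) ∂P = a := by
  rw [integral_add (integrable_const _) hX, h0]
  simp

namespace ParametricModel

variable {p q : ℕ} {𝒴 : Type*} [MeasurableSpace 𝒴] {M : ParametricModel p q 𝒴}

/-- One radius on which, for all candidate models, the roots of the population score equation are
the values of differentiable functions of the true parameter. -/
lemma LocalEnvelope.exists_radius {β₀ : M.par} {ρ ε K : ℝ} {b : 𝒴 → ℝ}
    (h : M.LocalEnvelope β₀ ρ b ε K) (hreg : M.Regular β₀) (𝓜 : Finset (Finset (Fin q))) :
    ∃ r > 0, ∃ φ : (k : Finset (Fin q)) → Param p q → SubParam p k,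
      (∀ k, φ k β₀ = restrict k (β₀ : Param p q)) ∧
      (∀ k, HasFDerivAt (φ k) (Matrix.toEuclideanCLM (𝕜 := ℝ) (M.subFisher β₀ k)⁻¹ ∘L
        restrictCLM p k ∘L Matrix.toEuclideanCLM (𝕜 := ℝ) (M.fisher β₀)) (β₀ : Param p q)) ∧
      ∀ k ∈ 𝓜, ∀ β : M.par, (β : Param p q) ∈ Metric.ball (β₀ : Param p q) r →
        ∀ x ∈ Metric.ball (restrict k (β₀ : Param p q)) r,
          (M.IsScoreRoot β₀ β k x ↔ φ k β = x) := by
  choose φ hφ0 hφ' hφ using h.exists_root_function hreg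
  have hev : ∀ᶠ r : ℝ in 𝓝[>] 0, ∀ k ∈ 𝓜, ∀ β : M.par,
      (β : Param p q) ∈ Metric.ball (β₀ : Param p q) r →
        ∀ x ∈ Metric.ball (restrict k (β₀ : Param p q)) r,
          (M.IsScoreRoot β₀ β k x ↔ φ k β = x) := by
    refine (eventually_all_finset 𝓜).2 fun k _ => ?_
    obtain ⟨r₀, hr₀, hball⟩ := Metric.eventually_nhds_iff_ball.1 (hφ k)
    filter_upwards [Ioc_mem_nhdsGT hr₀] with r hr β hβ x hx
    have h1 := hball ((β : Param p q), x) (by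
      rw [← ball_prod_same]
      exact ⟨Metric.ball_subset_ball hr.2 hβ, Metric.ball_subset_ball hr.2 hx⟩)
    rw [h.isScoreRoot_iff h1.1 h1.2.1]
    exact h1.2.2
  obtain ⟨r, hr, hr0⟩ := (hev.and self_mem_nhdsWithin).exists
  exact ⟨r, hr0, φ, hφ0, hφ', hr⟩

end ParametricModel

end ModelAveraging

theorem corollary2 {p q : ℕ} {𝒴 : Type*} [MeasurableSpace 𝒴] (M : ParametricModel p q 𝒴)
    -- the narrow parameter `β₀ = (θ₀, γ₀)`, at which the regularity conditions hold
    (β₀ : M.par) (hreg : M.Regular β₀)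
    -- the true parameter `(θ₀, γ₀ + δ/√n)`
    (δ : Fin q → ℝ) (βtrue : ℕ → M.par)
    (hβtrue : ∀ n, (βtrue n : Param p q) = localParam β₀ δ n)
    -- the parameter of interest
    (μ : Param p q → ℝ) (hμ : ContDiffAt ℝ 1 μ (β₀ : Param p q))
    -- the candidate models and their weights
    (𝓜 : Finset (Finset (Fin q))) (w : Finset (Fin q) → ℝ)
    (hw : ∀ k ∈ 𝓜, 0 ≤ w k ∧ w k ≤ 1) (hw1 : ∑ k ∈ 𝓜, w k = 1) :
    -- the score equation of every candidate model is uniquely solvable near `β_{0,k}`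
    ∃ r > 0,
      (∀ k ∈ 𝓜, ∀ᶠ n in atTop, ∃! b : SubParam p k,
        b ∈ Metric.ball (restrict k (β₀ : Param p q)) r ∧ M.IsScoreRoot β₀ (βtrue n) k b) ∧
      -- and for its solutions `β*_k` the following holds
      ∀ βstar : ℕ → (k : Finset (Fin q)) → SubParam p k,
        (∀ k ∈ 𝓜, ∀ᶠ n in atTop, βstar n k ∈ Metric.ball (restrict k (β₀ : Param p q)) r ∧
          M.IsScoreRoot β₀ (βtrue n) k (βstar n k)) →
        -- the first and second derivatives of the log-likelihoods have the moments used below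
        (∀ k ∈ 𝓜, ∀ᶠ n in atTop,
          MemLp (fun y => M.subScore β₀ k y (βstar n k)) 2 (M.law (βtrue n)) ∧
          ∀ i j, Integrable (fun y => M.subHessian β₀ k y (βstar n k) i j)
            (M.law (βtrue n))) ∧
        -- the bias term converges to the mean of `∑ w_k Λ_k`
        Tendsto (fun n : ℕ => √(n : ℝ) *
            ∑ k ∈ 𝓜, w k * (μ (augment β₀ k (βstar n k)) - μ (βtrue n))) atTop
          (𝓝 (∫ z, M.hcSum β₀ δ μ 𝓜 w z ∂(multivariateGaussian 0 (M.fisher β₀)))) ∧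
        -- the limits `H_k` exist and are invertible
        ∃ H : (k : Finset (Fin q)) → Matrix (Fin p ⊕ k) (Fin p ⊕ k) ℝ,
          (∀ k ∈ 𝓜, Tendsto (fun n : ℕ => M.meanHessian β₀ n (βtrue n) k (βstar n k)) atTop
            (𝓝 (H k)) ∧ IsUnit (H k).det) ∧
          -- the Lindeberg condition holds
          (∀ ε > 0, Tendsto (fun n : ℕ => (1 / (n : ℝ)) * ∑ i : Fin n, ∫ Y,
              (let D : ℝ :=
                ((𝓜.sup fun k => ‖M.influence β₀ μ k (H k) (βstar n k) (Y i)‖₊ : ℝ≥0) : ℝ)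
               Set.indicator {d : ℝ | √(n : ℝ) * ε < d} (fun d => d ^ 2) D)
              ∂(M.sampleLaw n (βtrue n))) atTop (𝓝 0)) ∧
          -- the asymptotic variance exists and equals the variance of `∑ w_k Λ_k`
          ∃ σ2 : ℝ≥0,
            Tendsto (fun n : ℕ => (1 / (n : ℝ)) * ∑ i : Fin n, ∫ Y,
                (∑ k ∈ 𝓜, w k * M.influence β₀ μ k (H k) (βstar n k) (Y i)) ^ 2
                ∂(M.sampleLaw n (βtrue n))) atTop (𝓝 (σ2 : ℝ)) ∧
            Var[M.hcSum β₀ δ μ 𝓜 w; multivariateGaussian 0 (M.fisher β₀)] = σ2 ∧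
            -- the same mean and variance belong to `∑ w_k Λ_k` built from the sample
            (∀ᶠ n : ℕ in atTop,
              MemLp (fun Y => M.hcSum β₀ δ μ 𝓜 w (M.scaledScore β₀ n (βtrue n) Y)) 2
                (M.sampleLaw n (βtrue n)) ∧
              ∫ Y, M.hcSum β₀ δ μ 𝓜 w (M.scaledScore β₀ n (βtrue n) Y)
                  ∂(M.sampleLaw n (βtrue n)) =
                ∫ z, M.hcSum β₀ δ μ 𝓜 w z ∂(multivariateGaussian 0 (M.fisher β₀))) ∧
            Tendsto (fun n : ℕ =>
                Var[fun Y => M.hcSum β₀ δ μ 𝓜 w (M.scaledScore β₀ n (βtrue n) Y);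
                  M.sampleLaw n (βtrue n)]) atTop (𝓝 (σ2 : ℝ)) ∧
            -- for all estimators, the bias-corrected limit theorem with variance `σ2` and the
            -- limit theorem with limit `∑ w_k Λ_k` are the same assertion
            ∀ βhat : (n : ℕ) → (k : Finset (Fin q)) → (Fin n → 𝒴) → SubParam p k,
              TendstoInDistribution
                  (fun (n : ℕ) (Y : Fin n → 𝒴) =>
                    √(n : ℝ) * ∑ k ∈ 𝓜, w k * (μ (augment β₀ k (βhat n k Y)) - μ (βtrue n))
                    - √(n : ℝ) *
                      ∑ k ∈ 𝓜, w k * (μ (augment β₀ k (βstar n k)) - μ (βtrue n)))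
                  atTop (id : ℝ → ℝ) (fun n => M.sampleLaw n (βtrue n)) (gaussianReal 0 σ2) ↔
                TendstoInDistribution
                  (fun (n : ℕ) (Y : Fin n → 𝒴) =>
                    √(n : ℝ) * (∑ k ∈ 𝓜, w k * μ (augment β₀ k (βhat n k Y)) - μ (βtrue n)))
                  atTop (M.hcSum β₀ δ μ 𝓜 w) (fun n => M.sampleLaw n (βtrue n))
                  (multivariateGaussian 0 (M.fisher β₀)) := by
  classical
  obtain ⟨ρ, b, ε, K, h⟩ := hreg.exists_localEnvelope
  have hβ : Tendsto (fun n => (βtrue n : Param p q)) atTop (𝓝 (β₀ : Param p q)) := by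
    simpa only [hβtrue] using ParametricModel.tendsto_localParam (β₀ : Param p q) δ
  have hβball : ∀ᶠ n in atTop, (βtrue n : Param p q) ∈ Metric.ball (β₀ : Param p q) ρ :=
    hβ.eventually (Metric.isOpen_ball.mem_nhds h.center_mem)
  obtain ⟨r, hr, φ, hφ0, hφ', hφ⟩ := h.exists_radius hreg 𝓜
  have hφlim : ∀ k, Tendsto (fun n => φ k (βtrue n)) atTop
      (𝓝 (restrict k (β₀ : Param p q))) := fun k => by
    rw [← hφ0 k]
    exact (hφ' k).continuousAt.tendsto.comp hβ
  have hβr : ∀ᶠ n in atTop, (βtrue n : Param p q) ∈ Metric.ball (β₀ : Param p q) r :=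
    hβ.eventually (Metric.ball_mem_nhds _ hr)
  refine ⟨r, hr, fun k hk => ?_, fun βstar hβstar => ?_⟩
  · filter_upwards [hβr, (hφlim k).eventually (Metric.ball_mem_nhds _ hr)] with n hn1 hn2
    refine ⟨φ k (βtrue n), ⟨hn2, (hφ k hk _ hn1 _ hn2).2 rfl⟩, fun x hx => ?_⟩
    exact ((hφ k hk _ hn1 x hx.1).1 hx.2).symm
  -- any choice of the roots agrees with the implicit functions for large `n`
  have heq : ∀ k ∈ 𝓜, ∀ᶠ n in atTop, βstar n k = φ k (βtrue n) := fun k hk => by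
    filter_upwards [hβr, hβstar k hk] with n hn1 hn2
    exact ((hφ k hk _ hn1 _ hn2.1).1 hn2.2).symm
  have hlim : ∀ k ∈ 𝓜, Tendsto (fun n => βstar n k) atTop
      (𝓝 (restrict k (β₀ : Param p q))) := fun k hk =>
    (hφlim k).congr' ((heq k hk).mono fun n hn => hn.symm)
  have hμd : DifferentiableAt ℝ μ (β₀ : Param p q) := hμ.differentiableAt (by norm_num)
  obtain ⟨a, ha⟩ : ∃ a, M.hcSum β₀ δ μ 𝓜 w 0 = a := ⟨_, rfl⟩
  let c := M.hcVec β₀ μ 𝓜 w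
  have hS : M.hcSum β₀ δ μ 𝓜 w = fun z => a + inner ℝ c z :=
    funext fun z => ha ▸ ParametricModel.hcSum_eq β₀ δ μ 𝓜 w z
  have hmean : ∫ z, M.hcSum β₀ δ μ 𝓜 w z ∂(multivariateGaussian 0 (M.fisher β₀)) =
      a := by
    simp only [hS]
    rw [integral_const_add_of_integral_eq_zero _ (integral_inner_multivariateGaussian _)]
    exact (innerSL ℝ _).integrable_comp IsGaussian.integrable_fun_id
  have hbias : Tendsto (fun n : ℕ => √(n : ℝ) *
      ∑ k ∈ 𝓜, w k * (μ (augment β₀ k (βstar n k)) - μ (βtrue n))) atTop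
      (𝓝 a) := by
    rw [← ha]
    have h1 : Tendsto (fun n : ℕ => ∑ k ∈ 𝓜, w k * (√(n : ℝ) *
        (μ (augment β₀ k (φ k (βtrue n))) - μ (βtrue n)))) atTop
        (𝓝 (M.hcSum β₀ δ μ 𝓜 w 0)) := by
      refine tendsto_finsetSum _ fun k _ => Tendsto.const_mul _ ?_
      simpa only [hβtrue] using ParametricModel.tendsto_bias hμd (hφ0 k) (hφ' k) δ
    refine h1.congr' ?_
    filter_upwards [(eventually_all_finset 𝓜).2 heq] with n hn
    rw [Finset.mul_sum]
    refine Finset.sum_congr rfl fun k hk => ?_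
    rw [hn k hk]
    ring
  refine ⟨fun k hk => ?_, hmean ▸ hbias, fun k => -M.subFisher β₀ k,
    fun k hk => ⟨h.tendsto_meanHessian hβ (hlim k hk), ?_⟩,
    fun η hη => h.tendsto_lindeberg hμ hβ hlim _ hη, ?_⟩
  · filter_upwards [hβball, (ParametricModel.LocalEnvelope.tendsto_augment (hlim k hk)).eventually
      (Metric.isOpen_ball.mem_nhds h.center_mem)] with n hn1 hn2
    exact ⟨h.memLp_subScore hn1 hn2, h.integrable_subHessian hn1 hn2⟩
  · rw [Matrix.det_neg]
    exact (isUnit_one.neg.pow _).mul (hreg.isUnit_det_subFisher k)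
  -- `E_{β₀} ⟪c, S⟫² = cᵀ J c`
  let σ2 : ℝ≥0 := ⟨∫ y, inner ℝ c (M.score y β₀) ^ 2 ∂(M.law β₀),
    integral_nonneg fun y => sq_nonneg _⟩
  have hσ : Var[fun z => inner ℝ c z; multivariateGaussian 0 (M.fisher β₀)] = σ2 :=
    h.variance_inner_multivariateGaussian hreg c
  refine ⟨σ2, h.tendsto_variance_influence hreg hμ hβ hlim fun k hk => (hw k hk).1, ?_, ?_, ?_,
    fun βhat => ?_⟩
  · rw [← hσ, hS]
    exact variance_const_add (by fun_prop) _
  · filter_upwards [hβball, eventually_ne_atTop 0] with n hn1 hn2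
    have h1 := h.memLp_inner_scaledScore hn1 c n
    rw [hmean]
    simp only [hS]
    have h2 : MemLp (fun _ : Fin n → 𝒴 => a) 2 (M.sampleLaw n (βtrue n)) := memLp_const a
    refine ⟨h2.add h1, ?_⟩
    exact integral_const_add_of_integral_eq_zero (h1.integrable one_le_two)
      (h.integral_inner_scaledScore hn1 c hn2)
  · refine (h.tendsto_variance_score hβ c).congr' ?_
    filter_upwards [hβball, eventually_ne_atTop 0] with n hn1 hn2
    rw [← h.variance_inner_scaledScore hn1 c hn2]
    simp only [hS]
    exact (variance_const_add (h.memLp_inner_scaledScore hn1 c n).1 _).symm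
  · have hmap : (multivariateGaussian 0 (M.fisher β₀)).map (M.hcSum β₀ δ μ 𝓜 w) =
        gaussianReal a σ2 := by
      rw [hS]
      exact map_add_inner_multivariateGaussian _ c hσ
    have hmeas : Measurable (M.hcSum β₀ δ μ 𝓜 w) := by
      rw [hS]
      fun_prop
    -- since the weights sum to one, the true value may be subtracted inside the average
    have hsum : ∀ n (Y : Fin n → 𝒴), ∑ k ∈ 𝓜, w k * (μ (augment β₀ k (βhat n k Y)) - μ (βtrue n)) =
        ∑ k ∈ 𝓜, w k * μ (augment β₀ k (βhat n k Y)) - μ (βtrue n) := fun n Y => by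
      simp only [mul_sub, Finset.sum_sub_distrib]
      rw [← Finset.sum_mul, hw1, one_mul]
    constructor
    · refine tendstoInDistribution_add_const hbias (fun n Y => ?_) hmeas.aemeasurable ?_
      · rw [hsum]
        ring
      · rw [hmap, Measure.map_id, gaussianReal_map_add_const, zero_add]
    · refine tendstoInDistribution_add_const hbias.neg (fun n Y => ?_) aemeasurable_id ?_
      · rw [hsum]
        ring
      · rw [hmap, Measure.map_id, gaussianReal_map_add_const, add_neg_cancel]
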